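/- Throughout, an étale groupoid is a second countable, locally compact, Hausdorff topological groupoid $\mathcal{G}$ whose range map $r$ (equivalently, whose source map $s$) is a local homeomorphism onto the unit space $\mathcal{G}^{(0)}$; a Cantor set is a non-empty compact, metrizable, totally disconnected space without isolated points; $\mathbb{Z}_2=\mathbb{Z}/2\mathbb{Z}$. Let $\mathcal{G}$ be an étale groupoid whose unit space is a Cantor set. Assume that $\mathcal{G}$ is essentially principal (the interior of $\{g: r(g)=s(g)\}$ is $\mathcal{G}^{(0)}$) and minimal (every orbit $r(s^{-1}(x))$ is dense in $\mathcal{G}^{(0)}$). A $\mathcal{G}$-set is a subset $U\subset\mathcal{G}$ on which $r$ and $s$ are injective; $U$ open induces the homeomorphism $\theta(U)=(r|_U)\circ(s|_U)^{-1}:s(U)\to r(U)$. Notation. * The topological full group $[[\mathcal{G}]]$ is the group of homeomorphisms of $\mathcal{G}^{(0)}$ of the form $\theta(U)$ with $U$ a compact open $\mathcal{G}$-set; such $U$ is unique. $[[\mathcal{G}]]_{ab}$ is its abelianization. * $H_n(\mathcal{G})$ is the $n$-th homology group of the complex $C_c(\mathcal{G}^{(n)},\mathbb{Z})$ with $\partial_n=\sum_{i=0}^n(-1)^i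 d_{i*}$, where $\mathcal{G}^{(n)}$ is the space of composable $n$-tuples, $(d_{i*}f)(y)=\sum_{d_i(x)=y}f(x)$, and the face maps are $d_0=s$, $d_1=r$ for $n=1$ and $d_0(g,h)=h$, $d_1(g,h)=gh$, $d_2(g,h)=g$ for $n=2$, and so on. In particular $H_0(\mathcal{G})=C(\mathcal{G}^{(0)},\mathbb{Z})/\operatorname{im}\partial_1$ and $H_1(\mathcal{G})=\ker\partial_1/\operatorname{im}\partial_2$. * The index map $I:[[\mathcal{G}]]\to H_1(\mathcal{G})$ is the homomorphism $I(\theta(U))=[1_U]$; the induced map $[[\mathcal{G}]]_{ab}\to H_1(\mathcal{G})$ is also denoted by $I$. * For a compact open $\mathcal{G}$-set $U$ with $r(U)\cap s(U)=\emptyset$, $\tau_U\in[[\mathcal{G}]]$ is the element equal to $\theta(U)$ on $s(U)$, to $\theta(U)^{-1}$ on $r(U)$, and to the identity elsewhere. Assume further that (a) $\mathcal{G}$ is purely infinite: for every clopen $A\subset\mathcal{G}^{(0)}$ there are compact open $\mathcal{G}$-sets $U,V$ with $s(U)=s(V)=A$, $r(U)\cup r(V)\subset A$ and $r(U)\cap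 r(V)=\emptyset$; (b) $\mathcal{G}$ has property TR: $\ker(I:[[\mathcal{G}]]\to H_1(\mathcal{G}))$ is generated by transpositions, i.e. by the $\tau\in[[\mathcal{G}]]$ such that $\tau^2=1$ and $\{x:\tau(x)=x\}$ is clopen. **Theorem.** The AH conjecture holds for $\mathcal{G}$: there is an exact sequence $$H_0(\mathcal{G})\otimes\mathbb{Z}_2\xrightarrow{\ j\ }[[\mathcal{G}]]_{ab}\xrightarrow{\ I\ }H_1(\mathcal{G})\to 0,$$ where $j$ is a homomorphism described as follows. For every $f\in C(\mathcal{G}^{(0)},\mathbb{Z})$ there are finitely many compact open $\mathcal{G}$-sets $U_1,\dots,U_n$ with $r(U_i)\cap s(U_i)=\emptyset$ whose sources $s(U_1),\dots,s(U_n)$ partition $\{x: f(x)\notin2\mathbb{Z}\}$, and for any such choice $j([f]\otimes\bar1)$ is the class of $\tau_{U_1}\tau_{U_2}\cdots\tau_{U_n}$. In particular, if $H_0(\mathcal{G})$ is $2$-divisible, then $I:[[\mathcal{G}]]_{ab}\to H_1(\mathcal{G})$ is an isomorphism. -/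

import Mathlib

open Set Topology Filter
open scoped CompactlySupported TensorProduct

/-! ### Functoriality of compactly supported functions along local homeomorphisms -/

section Pushforward

variable {X Y : Type*} [TopologicalSpace X] [TopologicalSpace Y]

theorem isLocalHomeomorph_of_isOpenMap {f : X → Y} (hc : Continuous f) (ho : IsOpenMap f)
    (hi : ∀ x, ∃ U, IsOpen U ∧ x ∈ U ∧ InjOn f U) : IsLocalHomeomorph f := by
  rw [isLocalHomeomorph_iff_isOpenEmbedding_restrict]
  intro x
  obtain ⟨U, hU, hx, hinj⟩ := hi x
  exact ⟨U, hU.mem_nhds hx, IsOpenEmbedding.of_continuous_injective_isOpenMap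
    (hc.comp continuous_subtype_val) (injOn_iff_injective.1 hinj) (ho.domRestrict hU)⟩

theorem isCompact_support_of_int (f : C_c(X, ℤ)) : IsCompact (Function.support f) := by
  have hcl : IsClosed (Function.support (f : X → ℤ)) :=
    (isClosed_discrete ({0}ᶜ : Set ℤ)).preimage f.continuous
  have := f.hasCompactSupport.isCompact
  rwa [tsupport, hcl.closure_eq] at this

theorem finite_fiber_inter_support [T2Space Y] {p : X → Y} (hp : IsLocalHomeomorph p)
    (f : C_c(X, ℤ)) (y : Y) : (p ⁻¹' {y} ∩ Function.support f).Finite := by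
  have hc : IsCompact (p ⁻¹' {y} ∩ Function.support f) :=
    (isCompact_support_of_int f).inter_left (isClosed_singleton.preimage hp.continuous)
  refine hc.finite ?_
  apply hp.isLocalHomeomorphOn.isDiscrete_of_image
  exact (Set.subsingleton_singleton.anti (by
    rintro _ ⟨x, hx, rfl⟩
    exact hx.1 : p '' (p ⁻¹' {y} ∩ Function.support f) ⊆ {y})).isDiscrete

theorem continuous_fiberSum [T2Space X] [T2Space Y] {p : X → Y} (hp : IsLocalHomeomorph p)
    (f : C_c(X, ℤ)) : Continuous (fun y => ∑ᶠ x ∈ p ⁻¹' {y}, f x) := by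
  rw [continuous_iff_continuousAt]
  intro y₀
  have hfin := finite_fiber_inter_support hp f y₀
  have hK := isCompact_support_of_int f
  set S := Function.support (f : X → ℤ) with hS
  set T := p ⁻¹' {y₀} ∩ S with hT
  obtain ⟨D, hD, hdisj⟩ := hfin.t2_separation
  have hW : ∀ x, ∃ W, IsOpen W ∧ x ∈ W ∧ W ⊆ D x ∧ InjOn p W ∧ ∀ z ∈ W, f z = f x := by
    intro x
    obtain ⟨e, hxe, rfl⟩ := hp x
    refine ⟨D x ∩ e.source ∩ f ⁻¹' {f x}, ((hD x).2.inter e.open_source).inter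
      ((isOpen_discrete _).preimage f.continuous), ⟨⟨(hD x).1, hxe⟩, rfl⟩,
      fun z hz => hz.1.1, e.injOn.mono fun z hz => hz.1.2, fun z hz => hz.2⟩
  choose W hWo hxW hWD hWi hWf using hW
  have hN1 : ∀ᶠ y in 𝓝 y₀, ∀ x ∈ T, y ∈ p '' W x := by
    rw [Filter.eventually_all_finite hfin]
    intro x hx
    exact (hp.isOpenMap _ (hWo x)).mem_nhds ⟨x, hxW x, hx.1⟩
  have hN2 : ∀ᶠ y in 𝓝 y₀, y ∉ p '' (S \ ⋃ x ∈ T, W x) := by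
    have hcomp : IsCompact (S \ ⋃ x ∈ T, W x) :=
      hK.diff (isOpen_biUnion fun x _ => hWo x)
    refine (hcomp.image hp.continuous).isClosed.isOpen_compl.mem_nhds ?_
    rintro ⟨x, ⟨hx, hx'⟩, hxy⟩
    exact hx' (mem_biUnion (show x ∈ T from ⟨hxy, hx⟩) (hxW x))
  refine ContinuousAt.congr (f := fun _ => ∑ᶠ x ∈ p ⁻¹' {y₀}, f x) continuousAt_const ?_
  filter_upwards [hN1, hN2] with y h1 h2
  choose! e heW hey using h1
  rw [← finsum_mem_inter_support (f := f) (s := p ⁻¹' {y₀}),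
    ← finsum_mem_inter_support (f := f) (s := p ⁻¹' {y})]
  refine finsum_mem_eq_of_bijOn e ⟨?_, ?_, ?_⟩ ?_
  · intro x hx
    refine ⟨hey x hx, ?_⟩
    have := hWf x _ (heW x hx)
    rw [Function.mem_support, this]
    exact hx.2
  · intro x hx x' hx' h
    by_contra hne
    exact Set.disjoint_left.1 (hdisj hx hx' hne) (hWD _ (heW x hx)) (h ▸ hWD _ (heW x' hx'))
  · rintro z ⟨hz, hzS⟩
    have : z ∈ ⋃ x ∈ T, W x := by
      by_contra hz'
      exact h2 ⟨z, ⟨hzS, hz'⟩, hz⟩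
    obtain ⟨x, hx, hzx⟩ := mem_iUnion₂.1 this
    exact ⟨x, hx, hWi x (heW x hx) hzx ((hey x hx).trans hz.symm)⟩
  · intro x hx
    exact (hWf x _ (heW x hx)).symm

/-- The homomorphism `C_c(X, ℤ) → C_c(Y, ℤ)` induced by a local homeomorphism `p : X → Y`,
`(p_* f)(y) = ∑_{p(x) = y} f(x)`. -/
noncomputable def pushforward [T2Space X] [T2Space Y] (p : X → Y) (hp : IsLocalHomeomorph p) :
    C_c(X, ℤ) →+ C_c(Y, ℤ) where
  toFun f :=
    { toFun := fun y => ∑ᶠ x ∈ p ⁻¹' {y}, f x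
      continuous_toFun := continuous_fiberSum hp f
      hasCompactSupport' := by
        refine HasCompactSupport.intro ((isCompact_support_of_int f).image hp.continuous) ?_
        intro y hy
        refine finsum_mem_eq_zero_of_forall_eq_zero fun x hx => ?_
        by_contra hne
        exact hy ⟨x, hne, hx⟩ }
  map_zero' := by
    ext y
    exact finsum_mem_zero _
  map_add' f g := by
    ext y
    exact finsum_mem_add_distrib' (finite_fiber_inter_support hp f y)
      (finite_fiber_inter_support hp g y)

/-- The characteristic function `1_A` of a compact open subset of a Hausdorff space. -/
noncomputable def charFun [T2Space X] (A : Set X) (hA : IsCompact A) (hA' : IsOpen A) :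
    C_c(X, ℤ) where
  toFun := A.indicator 1
  continuous_toFun := continuous_one.indicator fun x hx => by
    simp [IsClopen.frontier_eq ⟨hA.isClosed, hA'⟩] at hx
  hasCompactSupport' := HasCompactSupport.intro hA fun x hx => indicator_of_notMem hx _

theorem pushforward_charFun [T2Space X] [T2Space Y] {p : X → Y} (hp : IsLocalHomeomorph p)
    {A : Set X} (hA : IsCompact A) (hA' : IsOpen A) (hi : InjOn p A) {B : Set Y}
    (hB : IsCompact B) (hB' : IsOpen B) (hAB : p '' A = B) :
    pushforward p hp (charFun A hA hA') = charFun B hB hB' := by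
  subst hAB
  ext y
  change ∑ᶠ x ∈ p ⁻¹' {y}, A.indicator 1 x = (p '' A).indicator 1 y
  by_cases hy : y ∈ p '' A
  · obtain ⟨x, hx, rfl⟩ := hy
    rw [indicator_of_mem (mem_image_of_mem p hx)]
    have : p ⁻¹' {p x} ∩ Function.support (A.indicator (1 : X → ℤ)) = {x} := by
      ext z
      simp only [mem_inter_iff, mem_preimage, mem_singleton_iff, Function.mem_support, ne_eq,
        indicator_apply_eq_zero, Pi.one_apply, one_ne_zero, imp_false, not_not]
      exact ⟨fun h => hi h.2 hx h.1, fun h => by subst h; exact ⟨rfl, hx⟩⟩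
    rw [← finsum_mem_inter_support, this, finsum_mem_singleton, indicator_of_mem hx]
    rfl
  · rw [indicator_of_notMem hy]
    refine finsum_mem_eq_zero_of_forall_eq_zero fun x hx => indicator_of_notMem ?_ _
    exact fun h => hy ⟨x, h, hx⟩

end Pushforward

/-! ### Étale groupoids -/

/-- An étale groupoid with arrow space `G` and unit space `X`: a second countable, locally compact,
Hausdorff topological groupoid whose range map is a local homeomorphism.  The unit space is
identified with a subspace of `G` by means of `unit`, a continuous section of `r`. -/
structure EtaleGroupoid (X G : Type*) [TopologicalSpace X] [TopologicalSpace G]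
    [SecondCountableTopology G] [LocallyCompactSpace G] [T2Space G] where
  /-- the range map -/
  r : G → X
  /-- the source map -/
  s : G → X
  /-- the inclusion of the units -/
  unit : X → G
  /-- the inverse -/
  inv : G → G
  /-- the product `g h`, defined when `s g = r h` -/
  mul : (g h : G) → s g = r h → G
  r_unit : ∀ x, r (unit x) = x
  s_unit : ∀ x, s (unit x) = x
  r_inv : ∀ g, r (inv g) = s g
  s_inv : ∀ g, s (inv g) = r g
  r_mul : ∀ g h e, r (mul g h e) = r g
  s_mul : ∀ g h e, s (mul g h e) = s h
  unit_mul : ∀ g, mul (unit (r g)) g (s_unit _) = g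
  mul_unit : ∀ g, mul g (unit (s g)) (r_unit _).symm = g
  inv_mul : ∀ g, mul (inv g) g (s_inv g) = unit (s g)
  mul_inv : ∀ g, mul g (inv g) (r_inv g).symm = unit (r g)
  mul_assoc : ∀ g h k (e : s g = r h) (e' : s h = r k),
    mul (mul g h e) k ((s_mul g h e).trans e') = mul g (mul h k e') (e.trans (r_mul h k e').symm)
  continuous_unit : Continuous unit
  continuous_inv : Continuous inv
  continuous_mul : Continuous fun p : {p : G × G // s p.1 = r p.2} => mul p.1.1 p.1.2 p.2
  isLocalHomeomorph_r : IsLocalHomeomorph r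

namespace EtaleGroupoid

section Basic

variable {X G : Type*} [TopologicalSpace X] [TopologicalSpace G]
  [SecondCountableTopology G] [LocallyCompactSpace G] [T2Space G] (𝓖 : EtaleGroupoid X G)

/-- The space `𝓖⁽²⁾` of composable pairs. -/
abbrev Comp₂ : Type _ := {p : G × G // 𝓖.s p.1 = 𝓖.r p.2}

theorem inv_inv (g : G) : 𝓖.inv (𝓖.inv g) = g := by
  have h1 := 𝓖.mul_assoc (𝓖.inv (𝓖.inv g)) (𝓖.inv g) g
    (by rw [𝓖.s_inv]) (𝓖.s_inv g)
  have h2 := 𝓖.unit_mul g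
  have h3 := 𝓖.mul_unit (𝓖.inv (𝓖.inv g))
  simp only [𝓖.inv_mul] at h1
  rw [← h3]
  simp only [𝓖.s_inv, 𝓖.r_inv] at h1 ⊢
  rw [← h1, h2]

theorem inv_mul_cancel_left (g h : G) (e : 𝓖.s g = 𝓖.r h) :
    𝓖.mul (𝓖.inv g) (𝓖.mul g h e) ((𝓖.s_inv g).trans (𝓖.r_mul g h e).symm) = h := by
  rw [← 𝓖.mul_assoc (𝓖.inv g) g h (𝓖.s_inv g) e]
  simp only [𝓖.inv_mul, e, 𝓖.unit_mul]

theorem mul_inv_cancel_left (g h : G) (e : 𝓖.r g = 𝓖.r h) :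
    𝓖.mul g (𝓖.mul (𝓖.inv g) h ((𝓖.s_inv g).trans e))
      ((𝓖.r_inv g).symm.trans (𝓖.r_mul _ _ _).symm) = h := by
  rw [← 𝓖.mul_assoc g (𝓖.inv g) h (𝓖.r_inv g).symm]
  simp only [𝓖.mul_inv, e, 𝓖.unit_mul]

theorem mul_left_cancel {g h h' : G} {e : 𝓖.s g = 𝓖.r h} {e' : 𝓖.s g = 𝓖.r h'}
    (H : 𝓖.mul g h e = 𝓖.mul g h' e') : h = h' := by
  rw [← 𝓖.inv_mul_cancel_left g h e, ← 𝓖.inv_mul_cancel_left g h' e']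
  congr 1

/-- Inversion as a homeomorphism of the arrow space. -/
def invHomeomorph : G ≃ₜ G where
  toFun := 𝓖.inv
  invFun := 𝓖.inv
  left_inv := 𝓖.inv_inv
  right_inv := 𝓖.inv_inv
  continuous_toFun := 𝓖.continuous_inv
  continuous_invFun := 𝓖.continuous_inv

theorem isLocalHomeomorph_s : IsLocalHomeomorph 𝓖.s := by
  have : 𝓖.s = 𝓖.r ∘ 𝓖.invHomeomorph := by
    ext g
    exact (𝓖.r_inv g).symm
  rw [this]
  exact 𝓖.isLocalHomeomorph_r.comp 𝓖.invHomeomorph.isLocalHomeomorph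

/-- The product set `U V = {g h | g ∈ U, h ∈ V, s g = r h}`. -/
def setMul (U V : Set G) : Set G :=
  {k | ∃ g ∈ U, ∃ h ∈ V, ∃ e : 𝓖.s g = 𝓖.r h, 𝓖.mul g h e = k}

theorem isOpen_setMul {U V : Set G} (hU : IsOpen U) (hV : IsOpen V) :
    IsOpen (𝓖.setMul U V) := by
  rw [isOpen_iff_mem_nhds]
  rintro _ ⟨g, hg, h, hh, e, rfl⟩
  obtain ⟨φ, hgφ, hφ⟩ := 𝓖.isLocalHomeomorph_r g
  have hr : ∀ y ∈ φ.target, 𝓖.r (φ.symm y) = y := fun y hy => by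
    rw [hφ]
    exact φ.right_inv hy
  let P : Set G := 𝓖.r ⁻¹' φ.target
  have hP : IsOpen P := φ.open_target.preimage 𝓖.isLocalHomeomorph_r.continuous
  let σ : P → G := fun k => φ.symm (𝓖.r k.1)
  have hσ : Continuous σ := by
    refine φ.symm.continuousOn.comp_continuous
      (𝓖.isLocalHomeomorph_r.continuous.comp continuous_subtype_val) fun k => k.2
  have hσr : ∀ k : P, 𝓖.r (σ k) = 𝓖.r k.1 := fun k => hr _ k.2
  let τ : P → G := fun k => 𝓖.mul (𝓖.inv (σ k)) k.1 ((𝓖.s_inv _).trans (hσr k))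
  have hτ : Continuous τ :=
    𝓖.continuous_mul.comp (Continuous.subtype_mk
      ((𝓖.continuous_inv.comp hσ).prodMk continuous_subtype_val)
      fun k => (𝓖.s_inv _).trans (hσr k))
  have hopen : IsOpen (Subtype.val '' (σ ⁻¹' U ∩ τ ⁻¹' V)) :=
    hP.isOpenMap_subtype_val _ ((hU.preimage hσ).inter (hV.preimage hτ))
  have hkP : 𝓖.mul g h e ∈ P := by
    change 𝓖.r _ ∈ φ.target
    rw [𝓖.r_mul, hφ]
    exact φ.map_source hgφ
  have hσk : σ ⟨_, hkP⟩ = g := by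
    change φ.symm (𝓖.r (𝓖.mul g h e)) = g
    rw [𝓖.r_mul, hφ]
    exact φ.left_inv hgφ
  refine mem_of_superset (hopen.mem_nhds ⟨⟨_, hkP⟩, ⟨?_, ?_⟩, rfl⟩) ?_
  · rw [mem_preimage, hσk]
    exact hg
  · have : τ ⟨_, hkP⟩ = h := by
      refine Eq.trans ?_ (𝓖.inv_mul_cancel_left g h e)
      simp only [τ, hσk]
    rw [mem_preimage, this]
    exact hh
  · rintro _ ⟨k, ⟨hk1, hk2⟩, rfl⟩
    exact ⟨σ k, hk1, τ k, hk2, _, 𝓖.mul_inv_cancel_left _ _ (hσr k)⟩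

/-! ### The Moore complex of the nerve in degrees at most two -/

/-- The face map `d₀(g,h) = h`. -/
def face₀ (p : 𝓖.Comp₂) : G := p.1.2

/-- The face map `d₁(g,h) = gh`. -/
def face₁ (p : 𝓖.Comp₂) : G := 𝓖.mul p.1.1 p.1.2 p.2

/-- The face map `d₂(g,h) = g`. -/
def face₂ (p : 𝓖.Comp₂) : G := p.1.1

theorem isOpenMap_of_basic {Z : Type*} [TopologicalSpace Z] {f : 𝓖.Comp₂ → Z}
    (hf : ∀ U V : Set G, IsOpen U → IsOpen V →
      IsOpen (f '' {p | p.1.1 ∈ U ∧ p.1.2 ∈ V})) : IsOpenMap f := by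
  intro O hO
  rw [isOpen_iff_mem_nhds]
  rintro _ ⟨p, hp, rfl⟩
  obtain ⟨O', hO', rfl⟩ := isOpen_induced_iff.1 hO
  obtain ⟨U, V, hU, hV, hpU, hpV, hUV⟩ := isOpen_prod_iff.1 hO' p.1.1 p.1.2 hp
  refine mem_of_superset ((hf U V hU hV).mem_nhds ⟨p, ⟨hpU, hpV⟩, rfl⟩) ?_
  rintro _ ⟨q, ⟨hq1, hq2⟩, rfl⟩
  exact ⟨q, hUV ⟨hq1, hq2⟩, rfl⟩

theorem exists_open_injOn {Y Z : Type*} [TopologicalSpace Y] [TopologicalSpace Z] {f : Y → Z}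
    (hf : IsLocalHomeomorph f) (y : Y) : ∃ U, IsOpen U ∧ y ∈ U ∧ InjOn f U := by
  obtain ⟨φ, hy, rfl⟩ := hf y
  exact ⟨φ.source, φ.open_source, hy, φ.injOn⟩

theorem isLocalHomeomorph_face₀ : IsLocalHomeomorph 𝓖.face₀ := by
  have hc : Continuous 𝓖.face₀ := continuous_snd.comp continuous_subtype_val
  refine isLocalHomeomorph_of_isOpenMap hc (𝓖.isOpenMap_of_basic fun U V hU hV => ?_) fun p => ?_
  · have : 𝓖.face₀ '' {p | p.1.1 ∈ U ∧ p.1.2 ∈ V} = V ∩ 𝓖.r ⁻¹' (𝓖.s '' U) := by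
      ext h
      constructor
      · rintro ⟨p, ⟨h1, h2⟩, rfl⟩
        exact ⟨h2, p.1.1, h1, p.2⟩
      · rintro ⟨h1, g, hg, e⟩
        exact ⟨⟨(g, h), e⟩, ⟨hg, h1⟩, rfl⟩
    rw [this]
    exact hV.inter ((𝓖.isLocalHomeomorph_s.isOpenMap _ hU).preimage
      𝓖.isLocalHomeomorph_r.continuous)
  · obtain ⟨U, hU, hpU, hUi⟩ := exists_open_injOn 𝓖.isLocalHomeomorph_s p.1.1
    refine ⟨{q | q.1.1 ∈ U}, hU.preimage (continuous_fst.comp continuous_subtype_val), hpU, ?_⟩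
    intro q hq q' hq' h
    have h' : q.1.2 = q'.1.2 := h
    exact Subtype.ext (Prod.ext (hUi hq hq' (by rw [q.2, q'.2, h'])) h')

theorem isLocalHomeomorph_face₂ : IsLocalHomeomorph 𝓖.face₂ := by
  have hc : Continuous 𝓖.face₂ := continuous_fst.comp continuous_subtype_val
  refine isLocalHomeomorph_of_isOpenMap hc (𝓖.isOpenMap_of_basic fun U V hU hV => ?_) fun p => ?_
  · have : 𝓖.face₂ '' {p | p.1.1 ∈ U ∧ p.1.2 ∈ V} = U ∩ 𝓖.s ⁻¹' (𝓖.r '' V) := by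
      ext h
      constructor
      · rintro ⟨p, ⟨h1, h2⟩, rfl⟩
        exact ⟨h1, p.1.2, h2, p.2.symm⟩
      · rintro ⟨h1, g, hg, e⟩
        exact ⟨⟨(h, g), e.symm⟩, ⟨h1, hg⟩, rfl⟩
    rw [this]
    exact hU.inter ((𝓖.isLocalHomeomorph_r.isOpenMap _ hV).preimage
      𝓖.isLocalHomeomorph_s.continuous)
  · obtain ⟨U, hU, hpU, hUi⟩ := exists_open_injOn 𝓖.isLocalHomeomorph_r p.1.2
    refine ⟨{q | q.1.2 ∈ U}, hU.preimage (continuous_snd.comp continuous_subtype_val), hpU, ?_⟩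
    intro q hq q' hq' h
    have h' : q.1.1 = q'.1.1 := h
    exact Subtype.ext (Prod.ext h' (hUi hq hq' (by rw [← q.2, ← q'.2, h'])))

theorem isLocalHomeomorph_face₁ : IsLocalHomeomorph 𝓖.face₁ := by
  refine isLocalHomeomorph_of_isOpenMap 𝓖.continuous_mul
    (𝓖.isOpenMap_of_basic fun U V hU hV => ?_) fun p => ?_
  · have : 𝓖.face₁ '' {p | p.1.1 ∈ U ∧ p.1.2 ∈ V} = 𝓖.setMul U V := by
      ext k
      constructor
      · rintro ⟨p, ⟨h1, h2⟩, rfl⟩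
        exact ⟨_, h1, _, h2, p.2, rfl⟩
      · rintro ⟨g, hg, h, hh, e, rfl⟩
        exact ⟨⟨(g, h), e⟩, ⟨hg, hh⟩, rfl⟩
    rw [this]
    exact 𝓖.isOpen_setMul hU hV
  · obtain ⟨U, hU, hpU, hUi⟩ := exists_open_injOn 𝓖.isLocalHomeomorph_r p.1.1
    refine ⟨{q | q.1.1 ∈ U}, hU.preimage (continuous_fst.comp continuous_subtype_val), hpU, ?_⟩
    rintro ⟨⟨g, h⟩, e⟩ hq ⟨⟨g', h'⟩, e'⟩ hq' H
    change 𝓖.mul g h e = 𝓖.mul g' h' e' at H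
    obtain rfl : g = g' := hUi hq hq' (by
      change 𝓖.r g = 𝓖.r g'
      rw [← 𝓖.r_mul g h e, H, 𝓖.r_mul])
    obtain rfl : h = h' := 𝓖.mul_left_cancel H
    rfl

variable [T2Space X]

/-- `∂₁ = d₀_* - d₁_* = s_* - r_* : C_c(𝓖, ℤ) → C_c(𝓖⁽⁰⁾, ℤ)`. -/
noncomputable def boundary₁ : C_c(G, ℤ) →+ C_c(X, ℤ) :=
  pushforward 𝓖.s 𝓖.isLocalHomeomorph_s - pushforward 𝓖.r 𝓖.isLocalHomeomorph_r

/-- `∂₂ = d₀_* - d₁_* + d₂_* : C_c(𝓖⁽²⁾, ℤ) → C_c(𝓖, ℤ)`. -/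
noncomputable def boundary₂ : C_c(𝓖.Comp₂, ℤ) →+ C_c(G, ℤ) :=
  pushforward 𝓖.face₀ 𝓖.isLocalHomeomorph_face₀ - pushforward 𝓖.face₁ 𝓖.isLocalHomeomorph_face₁
    + pushforward 𝓖.face₂ 𝓖.isLocalHomeomorph_face₂

/-- `H₀(𝓖) = C_c(𝓖⁽⁰⁾, ℤ) / im ∂₁`. -/
abbrev H₀ : Type _ := C_c(X, ℤ) ⧸ 𝓖.boundary₁.range

/-- `H₁(𝓖) = ker ∂₁ / im ∂₂`. -/
abbrev H₁ : Type _ := 𝓖.boundary₁.ker ⧸ 𝓖.boundary₂.range.addSubgroupOf 𝓖.boundary₁.ker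

end Basic

/-! ### Compact open bisections and the topological full group -/

section FullGroup

variable {X G : Type*} [TopologicalSpace X] [TopologicalSpace G]
  [SecondCountableTopology G] [LocallyCompactSpace G] [T2Space G] (𝓖 : EtaleGroupoid X G)

/-- Every orbit `r(s⁻¹(x))` is dense in the unit space. -/
def IsMinimal : Prop := ∀ x, Dense (𝓖.r '' {g | 𝓖.s g = x})

/-- The interior of the isotropy bundle is the unit space. -/
def IsEssentiallyPrincipal : Prop := interior {g | 𝓖.r g = 𝓖.s g} = range 𝓖.unit

/-- `U` is a compact open `𝓖`-set. -/
structure IsCompactOpenGSet (U : Set G) : Prop where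
  isCompact : IsCompact U
  isOpen : IsOpen U
  injOn_r : InjOn 𝓖.r U
  injOn_s : InjOn 𝓖.s U

/-- `α = θ(U)`, i.e. `s(U) = 𝓖⁽⁰⁾` and `α (s g) = r g` for all `g ∈ U`. -/
structure IsTheta (U : Set G) (α : X ≃ₜ X) : Prop where
  image_s : 𝓖.s '' U = univ
  apply_s : ∀ g ∈ U, α (𝓖.s g) = 𝓖.r g

variable {𝓖}

theorem IsTheta.image_r {U : Set G} {α : X ≃ₜ X} (h : 𝓖.IsTheta U α) : 𝓖.r '' U = univ := by
  refine eq_univ_of_forall fun x => ?_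
  obtain ⟨g, hg, e⟩ := h.image_s.ge (mem_univ (α.symm x))
  exact ⟨g, hg, by rw [← h.apply_s g hg, e, α.apply_symm_apply]⟩

theorem isOpen_range_unit (𝓖 : EtaleGroupoid X G) : IsOpen (range 𝓖.unit) := by
  rw [isOpen_iff_mem_nhds]
  rintro _ ⟨x, rfl⟩
  obtain ⟨U, hU, hx, hi⟩ := exists_open_injOn 𝓖.isLocalHomeomorph_r (𝓖.unit x)
  have h1 : ∀ᶠ g in 𝓝 (𝓖.unit x), 𝓖.unit (𝓖.r g) ∈ U := by
    have hc : Continuous fun g => 𝓖.unit (𝓖.r g) :=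
      𝓖.continuous_unit.comp 𝓖.isLocalHomeomorph_r.continuous
    refine hc.continuousAt (hU.mem_nhds ?_)
    rwa [𝓖.r_unit]
  filter_upwards [h1, hU.mem_nhds hx] with g hg hgU
  exact ⟨𝓖.r g, hi hg hgU (𝓖.r_unit _)⟩

theorem isOpenMap_unit (𝓖 : EtaleGroupoid X G) : IsOpenMap 𝓖.unit := by
  intro A hA
  have : 𝓖.unit '' A = range 𝓖.unit ∩ 𝓖.r ⁻¹' A := by
    ext g
    constructor
    · rintro ⟨x, hx, rfl⟩
      exact ⟨⟨x, rfl⟩, by rwa [mem_preimage, 𝓖.r_unit]⟩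
    · rintro ⟨⟨x, rfl⟩, hx⟩
      rw [mem_preimage, 𝓖.r_unit] at hx
      exact ⟨x, hx, rfl⟩
  rw [this]
  exact 𝓖.isOpen_range_unit.inter (hA.preimage 𝓖.isLocalHomeomorph_r.continuous)

theorem IsCompactOpenGSet.image_unit (𝓖 : EtaleGroupoid X G) {A : Set X} (hA : IsCompact A)
    (hA' : IsOpen A) : 𝓖.IsCompactOpenGSet (𝓖.unit '' A) where
  isCompact := hA.image 𝓖.continuous_unit
  isOpen := 𝓖.isOpenMap_unit _ hA'
  injOn_r := by
    rintro _ ⟨x, -, rfl⟩ _ ⟨y, -, rfl⟩ h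
    rw [𝓖.r_unit, 𝓖.r_unit] at h
    rw [h]
  injOn_s := by
    rintro _ ⟨x, -, rfl⟩ _ ⟨y, -, rfl⟩ h
    rw [𝓖.s_unit, 𝓖.s_unit] at h
    rw [h]

theorem IsCompactOpenGSet.inv {U : Set G} (hU : 𝓖.IsCompactOpenGSet U) :
    𝓖.IsCompactOpenGSet (𝓖.inv '' U) where
  isCompact := hU.isCompact.image 𝓖.continuous_inv
  isOpen := 𝓖.invHomeomorph.isOpenMap _ hU.isOpen
  injOn_r := by
    rintro _ ⟨x, hx, rfl⟩ _ ⟨y, hy, rfl⟩ h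
    rw [𝓖.r_inv, 𝓖.r_inv] at h
    rw [hU.injOn_s hx hy h]
  injOn_s := by
    rintro _ ⟨x, hx, rfl⟩ _ ⟨y, hy, rfl⟩ h
    rw [𝓖.s_inv, 𝓖.s_inv] at h
    rw [hU.injOn_r hx hy h]

theorem isCompact_comp₂ [T2Space X] {U V : Set G} (hU : IsCompact U) (hV : IsCompact V) :
    IsCompact {p : 𝓖.Comp₂ | p.1.1 ∈ U ∧ p.1.2 ∈ V} := by
  have hcl : IsClosed {p : G × G | 𝓖.s p.1 = 𝓖.r p.2} :=
    isClosed_eq (𝓖.isLocalHomeomorph_s.continuous.comp continuous_fst)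
      (𝓖.isLocalHomeomorph_r.continuous.comp continuous_snd)
  exact hcl.isClosedEmbedding_subtypeVal.isCompact_preimage (hU.prod hV)

theorem IsCompactOpenGSet.mul [T2Space X] {U V : Set G} (hU : 𝓖.IsCompactOpenGSet U)
    (hV : 𝓖.IsCompactOpenGSet V) : 𝓖.IsCompactOpenGSet (𝓖.setMul U V) where
  isCompact := by
    have : 𝓖.setMul U V = 𝓖.face₁ '' {p | p.1.1 ∈ U ∧ p.1.2 ∈ V} := by
      ext k
      constructor
      · rintro ⟨g, hg, h, hh, e, rfl⟩
        exact ⟨⟨(g, h), e⟩, ⟨hg, hh⟩, rfl⟩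
      · rintro ⟨p, ⟨h1, h2⟩, rfl⟩
        exact ⟨_, h1, _, h2, p.2, rfl⟩
    rw [this]
    exact (isCompact_comp₂ hU.isCompact hV.isCompact).image 𝓖.continuous_mul
  isOpen := 𝓖.isOpen_setMul hU.isOpen hV.isOpen
  injOn_r := by
    rintro _ ⟨g, hg, h, hh, e, rfl⟩ _ ⟨g', hg', h', hh', e', rfl⟩ H
    rw [𝓖.r_mul, 𝓖.r_mul] at H
    obtain rfl := hU.injOn_r hg hg' H
    obtain rfl := hV.injOn_r hh hh' (e.symm.trans e')
    rfl
  injOn_s := by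
    rintro _ ⟨g, hg, h, hh, e, rfl⟩ _ ⟨g', hg', h', hh', e', rfl⟩ H
    rw [𝓖.s_mul, 𝓖.s_mul] at H
    obtain rfl := hV.injOn_s hh hh' H
    obtain rfl := hU.injOn_s hg hg' (e.trans e'.symm)
    rfl

theorem IsTheta.mul {U V : Set G} {α β : X ≃ₜ X} (hU : 𝓖.IsTheta U α) (hV : 𝓖.IsTheta V β) :
    𝓖.IsTheta (𝓖.setMul U V) (α * β) where
  image_s := by
    refine eq_univ_of_forall fun x => ?_
    obtain ⟨h, hh, rfl⟩ := hV.image_s.ge (mem_univ x)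
    obtain ⟨g, hg, e⟩ := hU.image_s.ge (mem_univ (𝓖.r h))
    exact ⟨_, ⟨g, hg, h, hh, e, rfl⟩, 𝓖.s_mul _ _ _⟩
  apply_s := by
    rintro _ ⟨g, hg, h, hh, e, rfl⟩
    rw [𝓖.s_mul, 𝓖.r_mul, Homeomorph.mul_apply, hV.apply_s h hh, ← e, hU.apply_s g hg]

theorem IsTheta.inv {U : Set G} {α : X ≃ₜ X} (hU : 𝓖.IsTheta U α) :
    𝓖.IsTheta (𝓖.inv '' U) α⁻¹ where
  image_s := by
    rw [← hU.image_r, image_image]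
    simp only [𝓖.s_inv]
  apply_s := by
    rintro _ ⟨g, hg, rfl⟩
    rw [𝓖.s_inv, 𝓖.r_inv, ← hU.apply_s g hg]
    exact α.symm_apply_apply _

theorem isTheta_one (𝓖 : EtaleGroupoid X G) : 𝓖.IsTheta (range 𝓖.unit) 1 where
  image_s := eq_univ_of_forall fun x => ⟨_, ⟨x, rfl⟩, 𝓖.s_unit x⟩
  apply_s := by
    rintro _ ⟨x, rfl⟩
    rw [𝓖.s_unit, 𝓖.r_unit]
    rfl

/-- If `𝓖` is essentially principal, the compact open `𝓖`-set `U` with `α = θ(U)` is unique. -/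
theorem IsTheta.unique (h : 𝓖.IsEssentiallyPrincipal) {U V : Set G} {α : X ≃ₜ X}
    (hU : 𝓖.IsCompactOpenGSet U) (hV : 𝓖.IsCompactOpenGSet V)
    (hUα : 𝓖.IsTheta U α) (hVα : 𝓖.IsTheta V α) : U = V := by
  have key : ∀ {U V : Set G}, 𝓖.IsCompactOpenGSet U → 𝓖.IsCompactOpenGSet V →
      𝓖.IsTheta U α → 𝓖.IsTheta V α → U ⊆ V := by
    intro U V hU hV hUα hVα g hg
    obtain ⟨g', hg', e⟩ := hVα.image_r.ge (mem_univ (𝓖.r g))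
    have hsub : 𝓖.setMul (𝓖.inv '' V) U ⊆ {g | 𝓖.r g = 𝓖.s g} := by
      rintro _ ⟨_, ⟨a, ha, rfl⟩, b, hb, e, rfl⟩
      rw [𝓖.s_inv, ← hVα.apply_s a ha, ← hUα.apply_s b hb] at e
      change 𝓖.r _ = 𝓖.s _
      rw [𝓖.r_mul, 𝓖.s_mul, 𝓖.r_inv, α.injective e]
    have hint : 𝓖.setMul (𝓖.inv '' V) U ⊆ range 𝓖.unit := by
      rw [← h]
      exact interior_maximal hsub (𝓖.isOpen_setMul hV.inv.isOpen hU.isOpen)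
    obtain ⟨x, hx⟩ := hint ⟨_, ⟨g', hg', rfl⟩, g, hg, (𝓖.s_inv g').trans e, rfl⟩
    have hxs : x = 𝓖.s g' := by
      rw [← 𝓖.r_unit x, hx, 𝓖.r_mul, 𝓖.r_inv]
    have aux : ∀ k (e' : 𝓖.s g' = 𝓖.r k), k = 𝓖.unit (𝓖.s g') → 𝓖.mul g' k e' = g' := by
      rintro _ _ rfl
      exact 𝓖.mul_unit g'
    have hgg : g = g' := by
      rw [← 𝓖.mul_inv_cancel_left g' g e]
      exact aux _ _ (by rw [← hx, hxs])
    rwa [hgg]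
  exact (key hU hV hUα hVα).antisymm (key hV hU hVα hUα)

variable (𝓖)

/-- The `𝓖`-set `U ∪ U⁻¹ ∪ (𝓖⁽⁰⁾ \ (s(U) ∪ r(U)))`. -/
def swapSet (U : Set G) : Set G :=
  U ∪ 𝓖.inv '' U ∪ 𝓖.unit '' (𝓖.s '' U ∪ 𝓖.r '' U)ᶜ

theorem image_s_swapSet (U : Set G) : 𝓖.s '' 𝓖.swapSet U = univ := by
  rw [swapSet, image_union, image_union, image_image, image_image]
  simp only [𝓖.s_inv, 𝓖.s_unit, image_id', union_compl_self]

theorem image_r_swapSet (U : Set G) : 𝓖.r '' 𝓖.swapSet U = univ := by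
  rw [swapSet, image_union, image_union, image_image, image_image]
  simp only [𝓖.r_inv, 𝓖.r_unit, image_id', union_comm (𝓖.s '' U), union_compl_self]

/-- The topological full group `[[𝓖]]`: all homeomorphisms of the unit space of the form `θ(U)`
with `U` a compact open `𝓖`-set. -/
def fullGroup [CompactSpace X] [T2Space X] : Subgroup (X ≃ₜ X) where
  carrier := {α | ∃ U, 𝓖.IsCompactOpenGSet U ∧ 𝓖.IsTheta U α}
  mul_mem' := by
    rintro α β ⟨U, hU, hUα⟩ ⟨V, hV, hVβ⟩
    exact ⟨_, hU.mul hV, hUα.mul hVβ⟩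
  one_mem' := ⟨range 𝓖.unit, by
    rw [← image_univ]
    exact IsCompactOpenGSet.image_unit 𝓖 isCompact_univ isOpen_univ, 𝓖.isTheta_one⟩
  inv_mem' := by
    rintro α ⟨U, hU, hUα⟩
    exact ⟨_, hU.inv, hUα.inv⟩

end FullGroup

/-! ### The index map -/

section Index

variable {X G : Type*} [TopologicalSpace X] [TopologicalSpace G]
  [SecondCountableTopology G] [LocallyCompactSpace G] [T2Space G] {𝓖 : EtaleGroupoid X G}
  [CompactSpace X] [T2Space X]

/-- `1_U ∈ C_c(𝓖, ℤ)` is a cycle if `θ(U)` is a homeomorphism of the unit space. -/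
theorem charFun_mem_ker {U : Set G} (hU : 𝓖.IsCompactOpenGSet U) {α : X ≃ₜ X}
    (hα : 𝓖.IsTheta U α) : charFun U hU.isCompact hU.isOpen ∈ 𝓖.boundary₁.ker := by
  rw [AddMonoidHom.mem_ker, boundary₁, AddMonoidHom.sub_apply,
    pushforward_charFun _ _ _ hU.injOn_s isCompact_univ isOpen_univ hα.image_s,
    pushforward_charFun _ _ _ hU.injOn_r isCompact_univ isOpen_univ hα.image_r, sub_self]

/-- The class `[1_U] ∈ H₁(𝓖)`. -/
noncomputable def cycleClass (U : Set G) (hU : 𝓖.IsCompactOpenGSet U) (α : X ≃ₜ X)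
    (hα : 𝓖.IsTheta U α) : 𝓖.H₁ :=
  QuotientAddGroup.mk ⟨charFun U hU.isCompact hU.isOpen, charFun_mem_ker hU hα⟩

theorem cycleClass_mul {U V : Set G} (hU : 𝓖.IsCompactOpenGSet U) (hV : 𝓖.IsCompactOpenGSet V)
    {α β : X ≃ₜ X} (hα : 𝓖.IsTheta U α) (hβ : 𝓖.IsTheta V β) :
    cycleClass (𝓖.setMul U V) (hU.mul hV) (α * β) (hα.mul hβ) =
      cycleClass U hU α hα + cycleClass V hV β hβ := by
  have hWc := isCompact_comp₂ (𝓖 := 𝓖) hU.isCompact hV.isCompact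
  have hWo : IsOpen {p : 𝓖.Comp₂ | p.1.1 ∈ U ∧ p.1.2 ∈ V} :=
    (hU.isOpen.prod hV.isOpen).preimage continuous_subtype_val
  have h₀ : pushforward 𝓖.face₀ 𝓖.isLocalHomeomorph_face₀ (charFun _ hWc hWo) =
      charFun V hV.isCompact hV.isOpen := by
    refine pushforward_charFun _ _ _ ?_ _ _ ?_
    · rintro ⟨⟨g, h⟩, e⟩ ⟨hg, hh⟩ ⟨⟨g', h'⟩, e'⟩ ⟨hg', hh'⟩ H
      obtain rfl : h = h' := H
      obtain rfl : g = g' := hU.injOn_s hg hg' (e.trans e'.symm)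
      rfl
    · ext h
      constructor
      · rintro ⟨p, ⟨h1, h2⟩, rfl⟩
        exact h2
      · intro hh
        obtain ⟨g, hg, e⟩ := hα.image_s.ge (mem_univ (𝓖.r h))
        exact ⟨⟨(g, h), e⟩, ⟨hg, hh⟩, rfl⟩
  have h₁ : pushforward 𝓖.face₁ 𝓖.isLocalHomeomorph_face₁ (charFun _ hWc hWo) =
      charFun (𝓖.setMul U V) (hU.mul hV).isCompact (hU.mul hV).isOpen := by
    refine pushforward_charFun _ _ _ ?_ _ _ ?_
    · rintro ⟨⟨g, h⟩, e⟩ ⟨hg, hh⟩ ⟨⟨g', h'⟩, e'⟩ ⟨hg', hh'⟩ H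
      change 𝓖.mul g h e = 𝓖.mul g' h' e' at H
      obtain rfl : g = g' := hU.injOn_r hg hg' (by
        rw [← 𝓖.r_mul g h e, H, 𝓖.r_mul])
      obtain rfl : h = h' := 𝓖.mul_left_cancel H
      rfl
    · ext k
      constructor
      · rintro ⟨p, ⟨h1, h2⟩, rfl⟩
        exact ⟨_, h1, _, h2, p.2, rfl⟩
      · rintro ⟨g, hg, h, hh, e, rfl⟩
        exact ⟨⟨(g, h), e⟩, ⟨hg, hh⟩, rfl⟩
  have h₂ : pushforward 𝓖.face₂ 𝓖.isLocalHomeomorph_face₂ (charFun _ hWc hWo) =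
      charFun U hU.isCompact hU.isOpen := by
    refine pushforward_charFun _ _ _ ?_ _ _ ?_
    · rintro ⟨⟨g, h⟩, e⟩ ⟨hg, hh⟩ ⟨⟨g', h'⟩, e'⟩ ⟨hg', hh'⟩ H
      obtain rfl : g = g' := H
      obtain rfl : h = h' := hV.injOn_r hh hh' (e.symm.trans e')
      rfl
    · ext g
      constructor
      · rintro ⟨p, ⟨h1, h2⟩, rfl⟩
        exact h1
      · intro hg
        obtain ⟨h, hh, e⟩ := hβ.image_r.ge (mem_univ (𝓖.s g))
        exact ⟨⟨(g, h), e.symm⟩, ⟨hg, hh⟩, rfl⟩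
  refine (QuotientAddGroup.eq (s := 𝓖.boundary₂.range.addSubgroupOf 𝓖.boundary₁.ker)).2 ?_
  rw [AddSubgroup.mem_addSubgroupOf]
  refine ⟨charFun _ hWc hWo, ?_⟩
  rw [boundary₂, AddMonoidHom.add_apply, AddMonoidHom.sub_apply, h₀, h₁, h₂]
  change _ = -charFun (𝓖.setMul U V) (hU.mul hV).isCompact (hU.mul hV).isOpen +
    (charFun U hU.isCompact hU.isOpen + charFun V hV.isCompact hV.isOpen)
  abel

theorem cycleClass_congr (h : 𝓖.IsEssentiallyPrincipal) {U V : Set G}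
    (hU : 𝓖.IsCompactOpenGSet U) (hV : 𝓖.IsCompactOpenGSet V)
    {α : X ≃ₜ X} (hα : 𝓖.IsTheta U α) (hβ : 𝓖.IsTheta V α) :
    cycleClass U hU α hα = cycleClass V hV α hβ := by
  obtain rfl := hα.unique h hU hV hβ
  rfl

variable (𝓖)

/-- The index map `I : [[𝓖]] → H₁(𝓖)`, `I(θ(U)) = [1_U]`, for essentially principal `𝓖`. -/
noncomputable def indexMap (h : 𝓖.IsEssentiallyPrincipal) :
    𝓖.fullGroup →* Multiplicative 𝓖.H₁ :=
  MonoidHom.mk' (fun α => Multiplicative.ofAdd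
    (cycleClass α.2.choose α.2.choose_spec.1 α.1 α.2.choose_spec.2)) fun α β => by
      rw [← ofAdd_add, ← cycleClass_mul]
      exact congrArg _ (cycleClass_congr h _ _ _ _)

theorem indexMap_apply (h : 𝓖.IsEssentiallyPrincipal) (α : 𝓖.fullGroup) {U : Set G}
    (hU : 𝓖.IsCompactOpenGSet U) (hα : 𝓖.IsTheta U α.1) :
    𝓖.indexMap h α = Multiplicative.ofAdd (cycleClass U hU α.1 hα) :=
  congrArg Multiplicative.ofAdd
    (cycleClass_congr h α.2.choose_spec.1 hU α.2.choose_spec.2 hα)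

/-- The homomorphism `[[𝓖]]_ab → H₁(𝓖)` induced by the index map, written additively. -/
noncomputable def abelianizedIndexMap (h : 𝓖.IsEssentiallyPrincipal) :
    Additive (Abelianization 𝓖.fullGroup) →+ 𝓖.H₁ :=
  MonoidHom.toAdditiveLeft (Abelianization.lift (𝓖.indexMap h))

/-- The homeomorphism `θ(W)`, as an element of `[[𝓖]]`, for a compact open `𝓖`-set `W` with
`s(W) = r(W) = 𝓖⁽⁰⁾`. -/
noncomputable def ofGSet (W : Set G) (hW : 𝓖.IsCompactOpenGSet W) (hs : 𝓖.s '' W = univ)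
    (hr : 𝓖.r '' W = univ) : 𝓖.fullGroup :=
  haveI : CompactSpace W := isCompact_iff_compactSpace.1 hW.isCompact
  let φs : W ≃ₜ X := Continuous.homeoOfEquivCompactToT2
    (f := Equiv.ofBijective (fun w : W => 𝓖.s w)
      ⟨injOn_iff_injective.1 hW.injOn_s, fun x => by
        obtain ⟨g, hg, e⟩ := hs.ge (mem_univ x)
        exact ⟨⟨g, hg⟩, e⟩⟩)
    (𝓖.isLocalHomeomorph_s.continuous.comp continuous_subtype_val)
  let φr : W ≃ₜ X := Continuous.homeoOfEquivCompactToT2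
    (f := Equiv.ofBijective (fun w : W => 𝓖.r w)
      ⟨injOn_iff_injective.1 hW.injOn_r, fun x => by
        obtain ⟨g, hg, e⟩ := hr.ge (mem_univ x)
        exact ⟨⟨g, hg⟩, e⟩⟩)
    (𝓖.isLocalHomeomorph_r.continuous.comp continuous_subtype_val)
  ⟨φs.symm.trans φr, W, hW, hs, fun g hg => by
    change φr (φs.symm (φs ⟨g, hg⟩)) = φr ⟨g, hg⟩
    rw [φs.symm_apply_apply]⟩

theorem isTheta_ofGSet {W : Set G} (hW : 𝓖.IsCompactOpenGSet W) (hs : 𝓖.s '' W = univ)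
    (hr : 𝓖.r '' W = univ) : 𝓖.IsTheta W (𝓖.ofGSet W hW hs hr).1 where
  image_s := hs
  apply_s g hg := by
    have : CompactSpace W := isCompact_iff_compactSpace.1 hW.isCompact
    change 𝓖.r _ = 𝓖.r g
    congr 1
    refine hW.injOn_s (Subtype.coe_prop _) hg ?_
    exact Equiv.apply_symm_apply (Equiv.ofBijective (fun w : W => 𝓖.s w)
      ⟨injOn_iff_injective.1 hW.injOn_s, fun x => by
        obtain ⟨g, hg, e⟩ := hs.ge (mem_univ x)
        exact ⟨⟨g, hg⟩, e⟩⟩) (𝓖.s g)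

theorem isCompactOpenGSet_swapSet {U : Set G} (hU : 𝓖.IsCompactOpenGSet U)
    (hd : 𝓖.r '' U ∩ 𝓖.s '' U = ∅) : 𝓖.IsCompactOpenGSet (𝓖.swapSet U) := by
  have hd' : ∀ g ∈ U, ∀ h ∈ U, 𝓖.r g ≠ 𝓖.s h := fun g hg h hh e =>
    (hd.le ⟨⟨g, hg, rfl⟩, ⟨h, hh, e.symm⟩⟩ : 𝓖.r g ∈ (∅ : Set X))
  have ho : IsOpen (𝓖.s '' U ∪ 𝓖.r '' U) :=
    (𝓖.isLocalHomeomorph_s.isOpenMap _ hU.isOpen).union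
      (𝓖.isLocalHomeomorph_r.isOpenMap _ hU.isOpen)
  have hc : IsCompact (𝓖.s '' U ∪ 𝓖.r '' U) :=
    (hU.isCompact.image 𝓖.isLocalHomeomorph_s.continuous).union
      (hU.isCompact.image 𝓖.isLocalHomeomorph_r.continuous)
  have hu := IsCompactOpenGSet.image_unit 𝓖 ho.isClosed_compl.isCompact hc.isClosed.isOpen_compl
  refine ⟨(hU.isCompact.union hU.inv.isCompact).union hu.isCompact,
    (hU.isOpen.union hU.inv.isOpen).union hu.isOpen, ?_, ?_⟩
  · rintro g ((hg | ⟨g, hg, rfl⟩) | ⟨x, hx, rfl⟩) h ((hh | ⟨h, hh, rfl⟩) | ⟨y, hy, rfl⟩) e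
    · exact hU.injOn_r hg hh e
    · rw [𝓖.r_inv] at e
      exact (hd' g hg h hh e).elim
    · rw [𝓖.r_unit] at e
      exact (hy (Or.inr ⟨g, hg, e⟩)).elim
    · rw [𝓖.r_inv] at e
      exact (hd' h hh g hg e.symm).elim
    · rw [𝓖.r_inv, 𝓖.r_inv] at e
      rw [hU.injOn_s hg hh e]
    · rw [𝓖.r_inv, 𝓖.r_unit] at e
      exact (hy (Or.inl ⟨g, hg, e⟩)).elim
    · rw [𝓖.r_unit] at e
      exact (hx (Or.inr ⟨h, hh, e.symm⟩)).elim
    · rw [𝓖.r_inv, 𝓖.r_unit] at e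
      exact (hx (Or.inl ⟨h, hh, e.symm⟩)).elim
    · rw [𝓖.r_unit, 𝓖.r_unit] at e
      rw [e]
  · rintro g ((hg | ⟨g, hg, rfl⟩) | ⟨x, hx, rfl⟩) h ((hh | ⟨h, hh, rfl⟩) | ⟨y, hy, rfl⟩) e
    · exact hU.injOn_s hg hh e
    · rw [𝓖.s_inv] at e
      exact (hd' h hh g hg e.symm).elim
    · rw [𝓖.s_unit] at e
      exact (hy (Or.inl ⟨g, hg, e⟩)).elim
    · rw [𝓖.s_inv] at e
      exact (hd' g hg h hh e).elim
    · rw [𝓖.s_inv, 𝓖.s_inv] at e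
      rw [hU.injOn_r hg hh e]
    · rw [𝓖.s_inv, 𝓖.s_unit] at e
      exact (hy (Or.inr ⟨g, hg, e⟩)).elim
    · rw [𝓖.s_unit] at e
      exact (hx (Or.inl ⟨h, hh, e.symm⟩)).elim
    · rw [𝓖.s_inv, 𝓖.s_unit] at e
      exact (hx (Or.inr ⟨h, hh, e.symm⟩)).elim
    · rw [𝓖.s_unit, 𝓖.s_unit] at e
      rw [e]

/-- The element `τ_U ∈ [[𝓖]]`, for a compact open `𝓖`-set `U` with `r(U) ∩ s(U) = ∅`: it is `θ(U)`
on `s(U)`, `θ(U⁻¹)` on `r(U)` and the identity elsewhere. -/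
noncomputable def swap (U : Set G) (hU : 𝓖.IsCompactOpenGSet U)
    (hd : 𝓖.r '' U ∩ 𝓖.s '' U = ∅) : 𝓖.fullGroup :=
  𝓖.ofGSet (𝓖.swapSet U) (𝓖.isCompactOpenGSet_swapSet hU hd) (𝓖.image_s_swapSet U)
    (𝓖.image_r_swapSet U)

theorem swap_s {U : Set G} (hU : 𝓖.IsCompactOpenGSet U) (hd : 𝓖.r '' U ∩ 𝓖.s '' U = ∅)
    {g : G} (hg : g ∈ U) : (𝓖.swap U hU hd).1 (𝓖.s g) = 𝓖.r g :=
  (𝓖.isTheta_ofGSet _ _ _).apply_s g (Or.inl (Or.inl hg))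

theorem swap_r {U : Set G} (hU : 𝓖.IsCompactOpenGSet U) (hd : 𝓖.r '' U ∩ 𝓖.s '' U = ∅)
    {g : G} (hg : g ∈ U) : (𝓖.swap U hU hd).1 (𝓖.r g) = 𝓖.s g := by
  have := (𝓖.isTheta_ofGSet (𝓖.isCompactOpenGSet_swapSet hU hd) (𝓖.image_s_swapSet U)
    (𝓖.image_r_swapSet U)).apply_s (𝓖.inv g) (Or.inl (Or.inr ⟨g, hg, rfl⟩))
  rwa [𝓖.s_inv, 𝓖.r_inv] at this

theorem swap_of_notMem {U : Set G} (hU : 𝓖.IsCompactOpenGSet U)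
    (hd : 𝓖.r '' U ∩ 𝓖.s '' U = ∅) {x : X} (hx : x ∉ 𝓖.s '' U ∪ 𝓖.r '' U) :
    (𝓖.swap U hU hd).1 x = x := by
  have := (𝓖.isTheta_ofGSet (𝓖.isCompactOpenGSet_swapSet hU hd) (𝓖.image_s_swapSet U)
    (𝓖.image_r_swapSet U)).apply_s (𝓖.unit x) (Or.inr ⟨x, hx, rfl⟩)
  rwa [𝓖.s_unit, 𝓖.r_unit] at this

/-- A transposition: `τ² = 1` and the fixed point set of `τ` is clopen. -/
def IsTransposition (τ : 𝓖.fullGroup) : Prop :=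
  τ ^ 2 = 1 ∧ IsClopen {x | τ.1 x = x}

/-- Property TR: the kernel `[[𝓖]]₀` of the index map is generated by transpositions. -/
def PropertyTR (h : 𝓖.IsEssentiallyPrincipal) : Prop :=
  (𝓖.indexMap h).ker = Subgroup.closure {τ | 𝓖.IsTransposition τ}

/-- A clopen set `A` is properly infinite if there are compact open `𝓖`-sets `U`, `V` with
`s(U) = s(V) = A`, `r(U) ∪ r(V) ⊆ A` and `r(U) ∩ r(V) = ∅`. -/
def IsProperlyInfinite (A : Set X) : Prop :=
  ∃ U V : Set G, 𝓖.IsCompactOpenGSet U ∧ 𝓖.IsCompactOpenGSet V ∧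
    𝓖.s '' U = A ∧ 𝓖.s '' V = A ∧ 𝓖.r '' U ∪ 𝓖.r '' V ⊆ A ∧ 𝓖.r '' U ∩ 𝓖.r '' V = ∅

/-- Every clopen subset of the unit space is properly infinite. -/
def IsPurelyInfinite : Prop := ∀ A : Set X, IsClopen A → 𝓖.IsProperlyInfinite A

/-- A finite family of compact open `𝓖`-sets `U₁, …, Uₙ` with `r(Uᵢ) ∩ s(Uᵢ) = ∅` whose sources
`s(Uᵢ)` form a partition of `A`. -/
structure IsSwapFamily {n : ℕ} (A : Set X) (U : Fin n → Set G) : Prop where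
  isCompactOpenGSet : ∀ i, 𝓖.IsCompactOpenGSet (U i)
  disjoint_range_source : ∀ i, 𝓖.r '' U i ∩ 𝓖.s '' U i = ∅
  pairwise_disjoint : Pairwise fun i j => Disjoint (𝓖.s '' U i) (𝓖.s '' U j)
  iUnion_eq : ⋃ i, 𝓖.s '' U i = A

/-- The description of the homomorphism `j : H₀(𝓖) ⊗ ℤ₂ → [[𝓖]]_ab`: for `f ∈ C(𝓖⁽⁰⁾, ℤ)`, the set
`A = {x | f(x) ∉ 2ℤ}` can be partitioned into the sources of compact open `𝓖`-sets `U₁, …, Uₙ` with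
`r(Uᵢ) ∩ s(Uᵢ) = ∅`, and for every such family `j` sends the class of `f` to the class of
`τ_{U₁} ⋯ τ_{Uₙ}`. -/
def IsSwapHom (j : (𝓖.H₀ ⊗[ℤ] ZMod 2) →+ Additive (Abelianization 𝓖.fullGroup)) : Prop :=
  ∀ f : C_c(X, ℤ),
    (∃ (n : ℕ) (U : Fin n → Set G), 𝓖.IsSwapFamily {x | Odd (f x)} U) ∧
    ∀ (n : ℕ) (U : Fin n → Set G) (hU : 𝓖.IsSwapFamily {x | Odd (f x)} U),
      j ((QuotientAddGroup.mk f : 𝓖.H₀) ⊗ₜ[ℤ] (1 : ZMod 2)) =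
        Additive.ofMul (Abelianization.of
          (List.ofFn fun i => 𝓖.swap (U i) (hU.isCompactOpenGSet i)
            (hU.disjoint_range_source i)).prod)

end Index

end EtaleGroupoid

/-! The homomorphism `j` exists because the class of `τ_U` in `[[𝓖]]_ab` depends only on `s(U)`
(`swapClass_eq_of_image_s_eq`). If `s(U) = s(V)` and `r(U)`, `r(V)` are disjoint, exchanging the two
ranges conjugates `τ_U` to `τ_V`. If some point lies outside `s(U) ∪ r(U) ∪ r(V)`, pure infiniteness
and minimality embed `s(U)` into the complement (`exists_gset_into`), and that embedding serves as
an intermediary between `U` and `V`. In general `s(U)` is cut into two non-empty clopen pieces, and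
each piece provides the free point needed for the other.

Every clopen set `A` thus has a class, additive on disjoint unions and killed by 2 since `τ_U² = 1`;
so `f ↦` class of `{f odd}` is additive. It vanishes on boundaries: for small `U`, the sets `s(U)`
and `r(U)` can both be swapped with one third set, and `τ_W = τ_{W⁻¹}`. It therefore factors through
`H₀ ⊗ ℤ₂`. Exactness in the middle is property TR together with the fact that every transposition is
some `τ_U`, with `s(U)` a clopen fundamental domain of the involution.

For surjectivity of `I` (`indexMap_surjective`), a cycle is, modulo `im ∂₂`, a sum of `1_{U_i}`.
Pure infiniteness provides disjoint copies of the unit space, and conjugating each `U_i` into its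
own copy makes the union a single `𝓖`-set `V`. The cycle condition says that the sets `r(U_i)` and
`s(U_i)` cover each point equally often; a common clopen refinement then yields a `𝓖`-set from
`r(V)` back to `s(V)` whose class cancels the error made by conjugating. The product, completed by
units, is an element of the full group. -/

/-! ### Induction over compact open sets -/

section CompactOpen

variable {Y : Type*} [TopologicalSpace Y] [T2Space Y]

/-- Induction over the compact open subsets of a Hausdorff space: a property which is stable under
disjoint unions and holds for all sufficiently small compact open sets holds for all of them. -/
theorem IsCompact.compactOpen_induction {P : Set Y → Prop} (hempty : P ∅)
    (hunion : ∀ A B, IsCompact A → IsOpen A → IsCompact B → IsOpen B → Disjoint A B →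
      P A → P B → P (A ∪ B)) {K : Set Y} (hK : IsCompact K) (hKo : IsOpen K)
    (hloc : ∀ x ∈ K, ∃ L, IsCompact L ∧ IsOpen L ∧ x ∈ L ∧
      ∀ A ⊆ L, IsCompact A → IsOpen A → P A) : P K := by
  -- `P` itself need not pass to subsets, so the covering argument runs with a hereditary version. A
  -- subset `C` of `L ∪ M` is then cut into the disjoint pieces `C ∩ L` and `C \ L`.
  have key : ∃ L, K ⊆ L ∧ IsClopen L ∧ ∀ A ⊆ L, IsCompact A → IsOpen A → P A := by
    refine hK.induction_on (p := fun K => ∃ L, K ⊆ L ∧ IsClopen L ∧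
      ∀ A ⊆ L, IsCompact A → IsOpen A → P A) ?_ ?_ ?_ ?_
    · refine ⟨∅, subset_rfl, isClopen_empty, fun A hA _ _ => ?_⟩
      rwa [subset_empty_iff.1 hA]
    · rintro A B hAB ⟨L, hL, h⟩
      exact ⟨L, hAB.trans hL, h⟩
    · rintro A B ⟨L, hL, hLc, h⟩ ⟨M, hM, hMc, h'⟩
      refine ⟨L ∪ M, union_subset_union hL hM, hLc.union hMc, fun C hC hc ho => ?_⟩
      rw [← inter_union_sdiff C L]
      refine hunion _ _ (hc.inter_right hLc.isClosed) (ho.inter hLc.isOpen) (hc.diff hLc.isOpen)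
        (ho.sdiff hLc.isClosed) (disjoint_sdiff_inter.symm)
        (h _ inter_subset_right (hc.inter_right hLc.isClosed) (ho.inter hLc.isOpen))
        (h' _ ?_ (hc.diff hLc.isOpen) (ho.sdiff hLc.isClosed))
      rw [sdiff_subset_iff]
      exact hC
    · intro x hx
      obtain ⟨L, hc, ho, hxL, h⟩ := hloc x hx
      exact ⟨L, mem_nhdsWithin_of_mem_nhds (ho.mem_nhds hxL), L, subset_rfl, ⟨hc.isClosed, ho⟩, h⟩
  obtain ⟨L, hL, -, h⟩ := key
  exact h K hL hK hKo

theorem charFun_apply (A : Set Y) (hA : IsCompact A) (hA' : IsOpen A) (y : Y) :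
    charFun A hA hA' y = A.indicator 1 y := rfl

theorem charFun_union {A B : Set Y} (hA : IsCompact A) (hA' : IsOpen A) (hB : IsCompact B)
    (hB' : IsOpen B) (h : Disjoint A B) :
    charFun (A ∪ B) (hA.union hB) (hA'.union hB') = charFun A hA hA' + charFun B hB hB' := by
  ext y
  exact congrFun (indicator_union_of_disjoint h 1) y

/-- A subgroup of `C_c(Y, ℤ)` which contains the characteristic functions of all sufficiently small
compact open sets is everything. -/
theorem mem_of_charFun_mem {S : AddSubgroup C_c(Y, ℤ)}
    (h : ∀ y, ∃ L, IsCompact L ∧ IsOpen L ∧ y ∈ L ∧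
      ∀ A ⊆ L, ∀ (hA : IsCompact A) (hA' : IsOpen A), charFun A hA hA' ∈ S) (f : C_c(Y, ℤ)) :
    f ∈ S := by
  have hSo : IsOpen (Function.support f) :=
    (isOpen_discrete ({0}ᶜ : Set ℤ)).preimage f.continuous
  -- Locally `f` is constant, so `1_K * f` is an integer multiple of `1_K` for small `K`. Taking `K`
  -- to be the support recovers `f`.
  have key : ∀ (hc : IsCompact (Function.support f)) (ho : IsOpen (Function.support f)),
      charFun _ hc ho * f ∈ S := by
    refine IsCompact.compactOpen_induction
      (P := fun K => ∀ (hc : IsCompact K) (ho : IsOpen K), charFun _ hc ho * f ∈ S) ?_ ?_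
      (isCompact_support_of_int f) hSo ?_
    · intro hc ho
      convert S.zero_mem
      ext y
      simp [charFun_apply]
    · intro A B hA hA' hB hB' hd h1 h2 hc ho
      rw [charFun_union hA hA' hB hB' hd, add_mul]
      exact S.add_mem (h1 _ _) (h2 _ _)
    · intro x _
      obtain ⟨L, hL, hL', hx, H⟩ := h x
      have hN : IsClopen (f ⁻¹' {f x}) := (isClopen_discrete _).preimage f.continuous
      refine ⟨L ∩ f ⁻¹' {f x}, hL.inter_right hN.isClosed, hL'.inter hN.isOpen, ⟨hx, rfl⟩, ?_⟩
      intro A hA _ _ hc ho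
      convert S.zsmul_mem (H A (hA.trans inter_subset_left) hc ho) (f x)
      ext y
      by_cases hy : y ∈ A
      · have : f y = f x := (hA hy).2
        simp [charFun_apply, hy, this]
      · simp [charFun_apply, hy]
  convert key (isCompact_support_of_int f) hSo
  ext y
  by_cases hy : f y = 0 <;> simp [charFun_apply, hy]

end CompactOpen

namespace EtaleGroupoid

/-! ### Compact open `𝓖`-sets and their products -/

section GSets

variable {X G : Type*} [TopologicalSpace X] [TopologicalSpace G]
  [SecondCountableTopology G] [LocallyCompactSpace G] [T2Space G] {𝓖 : EtaleGroupoid X G}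

theorem continuous_r : Continuous 𝓖.r := 𝓖.isLocalHomeomorph_r.continuous

theorem continuous_s : Continuous 𝓖.s := 𝓖.isLocalHomeomorph_s.continuous

/-- A clopen subset of the unit space, lifted by a local inverse of `r` into an open set where `s`
is also injective, is such a `𝓖`-set. Compact open `𝓖`-sets thus form a base of the topology. -/
theorem exists_isCompactOpenGSet [CompactSpace X] [T2Space X] [TotallyDisconnectedSpace X] {g : G}
    {O : Set G} (hO : IsOpen O) (hg : g ∈ O) :
    ∃ U, 𝓖.IsCompactOpenGSet U ∧ g ∈ U ∧ U ⊆ O := by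
  obtain ⟨φ, hgφ, hφ⟩ := 𝓖.isLocalHomeomorph_r g
  obtain ⟨S, hS, hgS, hSi⟩ := exists_open_injOn 𝓖.isLocalHomeomorph_s g
  have hN : IsOpen (φ.source ∩ (O ∩ S)) := φ.open_source.inter (hO.inter hS)
  obtain ⟨C, hC, hgC, hCN⟩ := compact_exists_isClopen_in_isOpen
    (𝓖.isLocalHomeomorph_r.isOpenMap _ hN) ⟨g, ⟨hgφ, hg, hgS⟩, rfl⟩
  have hCt : C ⊆ φ.target := by
    intro x hx
    obtain ⟨h, hh, rfl⟩ := hCN hx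
    rw [hφ]
    exact φ.map_source hh.1
  have hU : φ.symm '' C = φ.source ∩ φ ⁻¹' C := φ.symm_image_eq_source_inter_preimage hCt
  have hsub : φ.symm '' C ⊆ O ∩ S := by
    rintro _ ⟨x, hx, rfl⟩
    obtain ⟨h, hh, rfl⟩ := hCN hx
    rw [hφ, φ.left_inv hh.1]
    exact hh.2
  refine ⟨φ.symm '' C, ⟨?_, ?_, ?_, ?_⟩, ?_, hsub.trans inter_subset_left⟩
  · exact hC.isClosed.isCompact.image_of_continuousOn (φ.symm.continuousOn.mono hCt)
  · exact φ.symm.isOpen_image_of_subset_source hC.isOpen hCt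
  · rw [hU, hφ]
    exact φ.injOn.mono inter_subset_left
  · exact hSi.mono (hsub.trans inter_subset_right)
  · rw [hU]
    exact ⟨hgφ, by rw [mem_preimage, ← hφ]; exact hgC⟩

theorem IsCompactOpenGSet.subset {U V : Set G} (hU : 𝓖.IsCompactOpenGSet U) (hVU : V ⊆ U)
    (hc : IsCompact V) (ho : IsOpen V) : 𝓖.IsCompactOpenGSet V :=
  ⟨hc, ho, hU.injOn_r.mono hVU, hU.injOn_s.mono hVU⟩

theorem IsCompactOpenGSet.restrict {U : Set G} (hU : 𝓖.IsCompactOpenGSet U) {A : Set X}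
    (hA : IsClopen A) : 𝓖.IsCompactOpenGSet (U ∩ 𝓖.s ⁻¹' A) :=
  hU.subset inter_subset_left (hU.isCompact.inter_right (hA.isClosed.preimage continuous_s))
    (hU.isOpen.inter (hA.isOpen.preimage continuous_s))

theorem image_s_restrict (U : Set G) (A : Set X) : 𝓖.s '' (U ∩ 𝓖.s ⁻¹' A) = 𝓖.s '' U ∩ A :=
  image_inter_preimage _ _ _

theorem IsCompactOpenGSet.isClopen_s [T2Space X] {U : Set G} (hU : 𝓖.IsCompactOpenGSet U) :
    IsClopen (𝓖.s '' U) :=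
  ⟨(hU.isCompact.image continuous_s).isClosed, 𝓖.isLocalHomeomorph_s.isOpenMap _ hU.isOpen⟩

theorem IsCompactOpenGSet.isClopen_r [T2Space X] {U : Set G} (hU : 𝓖.IsCompactOpenGSet U) :
    IsClopen (𝓖.r '' U) :=
  ⟨(hU.isCompact.image continuous_r).isClosed, 𝓖.isLocalHomeomorph_r.isOpenMap _ hU.isOpen⟩

theorem isCompactOpenGSet_empty : 𝓖.IsCompactOpenGSet ∅ :=
  ⟨isCompact_empty, isOpen_empty, injOn_empty _, injOn_empty _⟩

theorem image_s_inv (U : Set G) : 𝓖.s '' (𝓖.inv '' U) = 𝓖.r '' U := by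
  simp only [image_image, 𝓖.s_inv]

theorem image_r_inv (U : Set G) : 𝓖.r '' (𝓖.inv '' U) = 𝓖.s '' U := by
  simp only [image_image, 𝓖.r_inv]

theorem image_s_unit (A : Set X) : 𝓖.s '' (𝓖.unit '' A) = A := by
  simp only [image_image, 𝓖.s_unit, image_id']

theorem image_r_unit (A : Set X) : 𝓖.r '' (𝓖.unit '' A) = A := by
  simp only [image_image, 𝓖.r_unit, image_id']

theorem image_s_setMul {U V : Set G} (h : 𝓖.r '' V ⊆ 𝓖.s '' U) :
    𝓖.s '' 𝓖.setMul U V = 𝓖.s '' V := by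
  ext x
  constructor
  · rintro ⟨_, ⟨a, _, b, hb, e, rfl⟩, rfl⟩
    exact ⟨b, hb, (𝓖.s_mul _ _ _).symm⟩
  · rintro ⟨b, hb, rfl⟩
    obtain ⟨a, ha, e⟩ := h ⟨b, hb, rfl⟩
    exact ⟨_, ⟨a, ha, b, hb, e, rfl⟩, 𝓖.s_mul _ _ _⟩

theorem image_r_setMul {U V : Set G} (h : 𝓖.s '' U ⊆ 𝓖.r '' V) :
    𝓖.r '' 𝓖.setMul U V = 𝓖.r '' U := by
  ext x
  constructor
  · rintro ⟨_, ⟨a, ha, b, _, e, rfl⟩, rfl⟩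
    exact ⟨a, ha, (𝓖.r_mul _ _ _).symm⟩
  · rintro ⟨a, ha, rfl⟩
    obtain ⟨b, hb, e⟩ := h ⟨a, ha, rfl⟩
    exact ⟨_, ⟨a, ha, b, hb, e.symm, rfl⟩, 𝓖.r_mul _ _ _⟩

theorem image_r_setMul_subset (U V : Set G) : 𝓖.r '' 𝓖.setMul U V ⊆ 𝓖.r '' U := by
  rintro _ ⟨_, ⟨a, ha, b, _, e, rfl⟩, rfl⟩
  exact ⟨a, ha, (𝓖.r_mul _ _ _).symm⟩

theorem disjoint_image_r_setMul {U V W : Set G} (hU : 𝓖.IsCompactOpenGSet U)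
    (h : Disjoint (𝓖.r '' V) (𝓖.r '' W)) :
    Disjoint (𝓖.r '' 𝓖.setMul U V) (𝓖.r '' 𝓖.setMul U W) := by
  rw [disjoint_left]
  rintro _ ⟨_, ⟨a, ha, b, hb, e, rfl⟩, rfl⟩ ⟨_, ⟨a', ha', b', hb', e', rfl⟩, H⟩
  rw [𝓖.r_mul, 𝓖.r_mul] at H
  obtain rfl := hU.injOn_r ha' ha H
  exact disjoint_left.1 h ⟨b, hb, rfl⟩ ⟨b', hb', by rw [← e, ← e']⟩

theorem IsCompactOpenGSet.union {U V : Set G} (hU : 𝓖.IsCompactOpenGSet U)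
    (hV : 𝓖.IsCompactOpenGSet V) (hr : Disjoint (𝓖.r '' U) (𝓖.r '' V))
    (hs : Disjoint (𝓖.s '' U) (𝓖.s '' V)) : 𝓖.IsCompactOpenGSet (U ∪ V) where
  isCompact := hU.isCompact.union hV.isCompact
  isOpen := hU.isOpen.union hV.isOpen
  injOn_r := (injOn_union (Disjoint.of_image hr)).2 ⟨hU.injOn_r, hV.injOn_r,
    fun a ha b hb e => disjoint_left.1 hr ⟨a, ha, rfl⟩ ⟨b, hb, e.symm⟩⟩
  injOn_s := (injOn_union (Disjoint.of_image hs)).2 ⟨hU.injOn_s, hV.injOn_s,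
    fun a ha b hb e => disjoint_left.1 hs ⟨a, ha, rfl⟩ ⟨b, hb, e.symm⟩⟩

end GSets

/-! ### Embeddings provided by pure infiniteness -/

section PurelyInfinite

variable {X G : Type*} [TopologicalSpace X] [TopologicalSpace G]
  [SecondCountableTopology G] [LocallyCompactSpace G] [T2Space G] {𝓖 : EtaleGroupoid X G}

theorem IsCompactOpenGSet.iUnion {ι : Type*} [Finite ι] {U : ι → Set G}
    (hU : ∀ i, 𝓖.IsCompactOpenGSet (U i))
    (hr : Pairwise fun i j => Disjoint (𝓖.r '' U i) (𝓖.r '' U j))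
    (hs : Pairwise fun i j => Disjoint (𝓖.s '' U i) (𝓖.s '' U j)) :
    𝓖.IsCompactOpenGSet (⋃ i, U i) where
  isCompact := isCompact_iUnion fun i => (hU i).isCompact
  isOpen := isOpen_iUnion fun i => (hU i).isOpen
  injOn_r := by
    intro a ha b hb e
    obtain ⟨i, hi⟩ := mem_iUnion.1 ha
    obtain ⟨j, hj⟩ := mem_iUnion.1 hb
    obtain rfl : i = j := by
      by_contra hij
      exact disjoint_left.1 (hr hij) ⟨a, hi, rfl⟩ ⟨b, hj, e.symm⟩
    exact (hU i).injOn_r hi hj e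
  injOn_s := by
    intro a ha b hb e
    obtain ⟨i, hi⟩ := mem_iUnion.1 ha
    obtain ⟨j, hj⟩ := mem_iUnion.1 hb
    obtain rfl : i = j := by
      by_contra hij
      exact disjoint_left.1 (hs hij) ⟨a, hi, rfl⟩ ⟨b, hj, e.symm⟩
    exact (hU i).injOn_s hi hj e

variable [T2Space X]

/-- In a properly infinite clopen set there are infinitely many disjoint copies of it. -/
theorem IsProperlyInfinite.exists_seq {B : Set X} (hB : 𝓖.IsProperlyInfinite B) :
    ∃ W : ℕ → Set G, (∀ i, 𝓖.IsCompactOpenGSet (W i)) ∧ (∀ i, 𝓖.s '' W i = B) ∧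
      (∀ i, 𝓖.r '' W i ⊆ B) ∧
      Pairwise fun i j => Disjoint (𝓖.r '' W i) (𝓖.r '' W j) := by
  obtain ⟨U, V, hU, hV, hUs, hVs, hr, hd⟩ := hB
  rw [union_subset_iff] at hr
  -- `W i = Vⁱ U`. The range of `W 0 = U` misses `r(V)`, which contains the range of every later `W
  -- i`; applying the injective `V` repeatedly separates the others.
  let W : ℕ → Set G := fun i => Nat.rec U (fun _ W => 𝓖.setMul V W) i
  have hsucc : ∀ i, W (i + 1) = 𝓖.setMul V (W i) := fun i => rfl
  have hW : ∀ i, 𝓖.IsCompactOpenGSet (W i) := fun i => by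
    induction i with
    | zero => exact hU
    | succ i ih => exact hV.mul ih
  have hWr : ∀ i, 𝓖.r '' W i ⊆ B := fun i => by
    cases i with
    | zero => exact hr.1
    | succ i => exact (image_r_setMul_subset _ _).trans hr.2
  have hWs : ∀ i, 𝓖.s '' W i = B := fun i => by
    induction i with
    | zero => exact hUs
    | succ i ih => rw [hsucc, image_s_setMul (hVs ▸ hWr i), ih]
  have hlt : ∀ i k, Disjoint (𝓖.r '' W i) (𝓖.r '' W (i + (k + 1))) := fun i k => by
    induction i with
    | zero =>
      rw [Nat.zero_add]
      exact (disjoint_iff_inter_eq_empty.2 hd).mono_right (image_r_setMul_subset _ _)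
    | succ i ih =>
      rw [Nat.add_right_comm, hsucc, hsucc]
      exact disjoint_image_r_setMul hV ih
  refine ⟨W, hW, hWs, hWr, fun i j hij => ?_⟩
  rcases lt_or_gt_of_ne hij with h | h
  · obtain ⟨k, rfl⟩ := Nat.exists_eq_add_of_lt h
    exact hlt i k
  · obtain ⟨k, rfl⟩ := Nat.exists_eq_add_of_lt h
    exact (hlt j k).symm

variable [CompactSpace X] [TotallyDisconnectedSpace X]

/-- In a minimal purely infinite groupoid, every clopen set embeds into every non-empty one. -/
theorem exists_gset_into (hmin : 𝓖.IsMinimal) (hpi : 𝓖.IsPurelyInfinite) {A B : Set X}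
    (hA : IsClopen A) (hB : IsClopen B) (hne : B.Nonempty) :
    ∃ U, 𝓖.IsCompactOpenGSet U ∧ 𝓖.s '' U = A ∧ 𝓖.r '' U ⊆ B := by
  obtain ⟨W, hW, hWs, hWr, hWd⟩ := (hpi B hB).exists_seq
  refine IsCompact.compactOpen_induction
    (P := fun A => ∃ U, 𝓖.IsCompactOpenGSet U ∧ 𝓖.s '' U = A ∧ 𝓖.r '' U ⊆ B)
    ⟨∅, isCompactOpenGSet_empty, image_empty _, by simp⟩ ?_ hA.isClosed.isCompact hA.isOpen ?_
  · rintro _ _ _ _ _ _ hd ⟨U, hU, rfl, hUr⟩ ⟨V, hV, rfl, hVr⟩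
    have h0 := image_s_setMul (𝓖 := 𝓖) (hUr.trans (hWs 0).ge)
    have h1 := image_s_setMul (𝓖 := 𝓖) (hVr.trans (hWs 1).ge)
    -- The ranges of `U` and `V` may overlap inside `B`; `W 0` and `W 1` move them into disjoint
    -- copies of `B` within `B`.
    refine ⟨𝓖.setMul (W 0) U ∪ 𝓖.setMul (W 1) V, ((hW 0).mul hU).union ((hW 1).mul hV)
      ((hWd zero_ne_one).mono (image_r_setMul_subset _ _) (image_r_setMul_subset _ _)) ?_,
      ?_, ?_⟩
    · rwa [h0, h1]
    · rw [image_union, h0, h1]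
    · rw [image_union]
      exact union_subset ((image_r_setMul_subset _ _).trans (hWr 0))
        ((image_r_setMul_subset _ _).trans (hWr 1))
  · intro x _
    -- The orbit of `x` meets `B`, so an arrow leads from `x` into `B`, and a small `𝓖`-set around
    -- it carries a neighbourhood of `x` into `B`.
    obtain ⟨_, ⟨g, rfl, rfl⟩, hgB⟩ := (hmin x).exists_mem_open hB.isOpen hne
    obtain ⟨U, hU, hg, hUB⟩ := exists_isCompactOpenGSet (𝓖 := 𝓖)
      (hB.isOpen.preimage continuous_r) hgB
    refine ⟨𝓖.s '' U, hU.isClopen_s.isClosed.isCompact, hU.isClopen_s.isOpen, ⟨g, hg, rfl⟩, ?_⟩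
    intro A hAU hc ho
    refine ⟨U ∩ 𝓖.s ⁻¹' A, hU.restrict ⟨hc.isClosed, ho⟩, ?_, ?_⟩
    · rw [image_s_restrict, inter_eq_right.2 hAU]
    · rw [image_subset_iff]
      exact inter_subset_left.trans hUB

end PurelyInfinite

/-! ### Classes of `𝓖`-sets modulo `im ∂₂` -/

section ChainClass

variable {X G : Type*} [TopologicalSpace X] [TopologicalSpace G]
  [SecondCountableTopology G] [LocallyCompactSpace G] [T2Space G] (𝓖 : EtaleGroupoid X G)

open Classical in
/-- The class of `1_U` in `C_c(𝓖, ℤ) / im ∂₂`, for a compact open set `U` (and zero otherwise). -/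
noncomputable def chainClass (U : Set G) : C_c(G, ℤ) ⧸ 𝓖.boundary₂.range :=
  if h : IsCompact U ∧ IsOpen U then QuotientAddGroup.mk (charFun U h.1 h.2) else 0

variable {𝓖}

theorem chainClass_eq {U : Set G} (hc : IsCompact U) (ho : IsOpen U) :
    𝓖.chainClass U = QuotientAddGroup.mk (charFun U hc ho) :=
  dif_pos ⟨hc, ho⟩

theorem chainClass_union {U V : Set G} (hU : 𝓖.IsCompactOpenGSet U)
    (hV : 𝓖.IsCompactOpenGSet V) (h : Disjoint U V) :
    𝓖.chainClass (U ∪ V) = 𝓖.chainClass U + 𝓖.chainClass V := by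
  rw [chainClass_eq hU.isCompact hU.isOpen, chainClass_eq hV.isCompact hV.isOpen,
    chainClass_eq (hU.isCompact.union hV.isCompact) (hU.isOpen.union hV.isOpen),
    charFun_union hU.isCompact hU.isOpen hV.isCompact hV.isOpen h]
  rfl

theorem chainClass_iUnion {ι : Type*} [Fintype ι] {U : ι → Set G}
    (hU : ∀ i, 𝓖.IsCompactOpenGSet (U i)) (h : Pairwise fun i j => Disjoint (U i) (U j)) :
    𝓖.chainClass (⋃ i, U i) = ∑ i, 𝓖.chainClass (U i) := by
  have hco : IsCompact (⋃ i, U i) ∧ IsOpen (⋃ i, U i) :=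
    ⟨isCompact_iUnion fun i => (hU i).isCompact, isOpen_iUnion fun i => (hU i).isOpen⟩
  have : charFun _ hco.1 hco.2 = ∑ i, charFun (U i) (hU i).isCompact (hU i).isOpen := by
    ext g
    have hsum : (∑ i, charFun (U i) (hU i).isCompact (hU i).isOpen) g =
        ∑ i, (U i).indicator (1 : G → ℤ) g := by
      simp [CompactlySupportedContinuousMap.coe_sum, charFun_apply]
    rw [hsum, charFun_apply]
    by_cases hg : g ∈ ⋃ i, U i
    · obtain ⟨i, hi⟩ := mem_iUnion.1 hg
      rw [indicator_of_mem hg, Finset.sum_eq_single i, indicator_of_mem hi]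
      · intro j _ hj
        exact indicator_of_notMem (fun hgj => disjoint_left.1 (h hj) hgj hi) _
      · simp
    · rw [indicator_of_notMem hg, Finset.sum_eq_zero]
      exact fun i _ => indicator_of_notMem (fun hi => hg (mem_iUnion.2 ⟨i, hi⟩)) _
  rw [chainClass_eq hco.1 hco.2, this, ← QuotientAddGroup.mk'_apply, map_sum]
  exact Finset.sum_congr rfl fun i _ => (chainClass_eq _ _).symm

variable [T2Space X]

/-- The boundary of the characteristic function of the composable pairs in `U × V` is `1_V - 1_{UV}
+ 1_U`. The hypothesis `s(U) = r(V)` makes the outer faces cover all of `V` and of `U`, so this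
extends `cycleClass_mul` to `𝓖`-sets that do not give elements of the full group. -/
theorem chainClass_setMul {U V : Set G} (hU : 𝓖.IsCompactOpenGSet U)
    (hV : 𝓖.IsCompactOpenGSet V) (hUV : 𝓖.s '' U = 𝓖.r '' V) :
    𝓖.chainClass (𝓖.setMul U V) = 𝓖.chainClass U + 𝓖.chainClass V := by
  have hWc := isCompact_comp₂ (𝓖 := 𝓖) hU.isCompact hV.isCompact
  have hWo : IsOpen {p : 𝓖.Comp₂ | p.1.1 ∈ U ∧ p.1.2 ∈ V} :=
    (hU.isOpen.prod hV.isOpen).preimage continuous_subtype_val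
  have h₀ : pushforward 𝓖.face₀ 𝓖.isLocalHomeomorph_face₀ (charFun _ hWc hWo) =
      charFun V hV.isCompact hV.isOpen := by
    refine pushforward_charFun _ _ _ ?_ _ _ ?_
    · rintro ⟨⟨g, h⟩, e⟩ ⟨hg, hh⟩ ⟨⟨g', h'⟩, e'⟩ ⟨hg', hh'⟩ H
      obtain rfl : h = h' := H
      obtain rfl : g = g' := hU.injOn_s hg hg' (e.trans e'.symm)
      rfl
    · ext h
      constructor
      · rintro ⟨p, ⟨h1, h2⟩, rfl⟩
        exact h2
      · intro hh
        obtain ⟨g, hg, e⟩ := hUV.ge ⟨h, hh, rfl⟩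
        exact ⟨⟨(g, h), e⟩, ⟨hg, hh⟩, rfl⟩
  have h₁ : pushforward 𝓖.face₁ 𝓖.isLocalHomeomorph_face₁ (charFun _ hWc hWo) =
      charFun (𝓖.setMul U V) (hU.mul hV).isCompact (hU.mul hV).isOpen := by
    refine pushforward_charFun _ _ _ ?_ _ _ ?_
    · rintro ⟨⟨g, h⟩, e⟩ ⟨hg, hh⟩ ⟨⟨g', h'⟩, e'⟩ ⟨hg', hh'⟩ H
      change 𝓖.mul g h e = 𝓖.mul g' h' e' at H
      obtain rfl : g = g' := hU.injOn_r hg hg' (by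
        rw [← 𝓖.r_mul g h e, H, 𝓖.r_mul])
      obtain rfl : h = h' := 𝓖.mul_left_cancel H
      rfl
    · ext k
      constructor
      · rintro ⟨p, ⟨h1, h2⟩, rfl⟩
        exact ⟨_, h1, _, h2, p.2, rfl⟩
      · rintro ⟨g, hg, h, hh, e, rfl⟩
        exact ⟨⟨(g, h), e⟩, ⟨hg, hh⟩, rfl⟩
  have h₂ : pushforward 𝓖.face₂ 𝓖.isLocalHomeomorph_face₂ (charFun _ hWc hWo) =
      charFun U hU.isCompact hU.isOpen := by
    refine pushforward_charFun _ _ _ ?_ _ _ ?_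
    · rintro ⟨⟨g, h⟩, e⟩ ⟨hg, hh⟩ ⟨⟨g', h'⟩, e'⟩ ⟨hg', hh'⟩ H
      obtain rfl : g = g' := H
      obtain rfl : h = h' := hV.injOn_r hh hh' (e.symm.trans e')
      rfl
    · ext g
      constructor
      · rintro ⟨p, ⟨h1, h2⟩, rfl⟩
        exact h1
      · intro hg
        obtain ⟨h, hh, e⟩ := hUV.le ⟨g, hg, rfl⟩
        exact ⟨⟨(g, h), e.symm⟩, ⟨hg, hh⟩, rfl⟩
  rw [chainClass_eq hU.isCompact hU.isOpen, chainClass_eq hV.isCompact hV.isOpen,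
    chainClass_eq (hU.mul hV).isCompact (hU.mul hV).isOpen, ← QuotientAddGroup.mk_add]
  refine QuotientAddGroup.eq.2 ⟨charFun _ hWc hWo, ?_⟩
  rw [boundary₂, AddMonoidHom.add_apply, AddMonoidHom.sub_apply, h₀, h₁, h₂]
  abel

/-- A set of units is idempotent under multiplication, so its class equals twice itself. -/
theorem chainClass_unit [CompactSpace X] {A : Set X} (hA : IsClopen A) :
    𝓖.chainClass (𝓖.unit '' A) = 0 := by
  have hu := IsCompactOpenGSet.image_unit 𝓖 hA.isClosed.isCompact hA.isOpen
  have := chainClass_setMul hu hu (by rw [image_s_unit, image_r_unit])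
  have hmul : 𝓖.setMul (𝓖.unit '' A) (𝓖.unit '' A) = 𝓖.unit '' A := by
    have aux : ∀ x h, 𝓖.mul (𝓖.unit x) (𝓖.unit x) h = 𝓖.unit x := fun x h => by
      have := 𝓖.mul_unit (𝓖.unit x)
      simpa only [𝓖.s_unit] using this
    ext g
    constructor
    · rintro ⟨_, ⟨x, hx, rfl⟩, _, ⟨y, hy, rfl⟩, e, rfl⟩
      obtain rfl : x = y := by rwa [𝓖.s_unit, 𝓖.r_unit] at e
      exact ⟨x, hx, (aux _ _).symm⟩
    · rintro ⟨x, hx, rfl⟩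
      exact ⟨_, ⟨x, hx, rfl⟩, _, ⟨x, hx, rfl⟩, by rw [𝓖.s_unit, 𝓖.r_unit], aux _ _⟩
  rwa [hmul, left_eq_add] at this

/-- The product `U⁻¹ U` is the set of units over `s(U)`, whose class is zero. -/
theorem chainClass_inv [CompactSpace X] {U : Set G} (hU : 𝓖.IsCompactOpenGSet U) :
    𝓖.chainClass (𝓖.inv '' U) = -𝓖.chainClass U := by
  have := chainClass_setMul hU.inv hU (image_s_inv U)
  have hmul : 𝓖.setMul (𝓖.inv '' U) U = 𝓖.unit '' (𝓖.s '' U) := by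
    ext g
    constructor
    · rintro ⟨_, ⟨a, ha, rfl⟩, b, hb, e, rfl⟩
      obtain rfl := hU.injOn_r ha hb (by rwa [𝓖.s_inv] at e)
      exact ⟨_, ⟨a, ha, rfl⟩, (𝓖.inv_mul a).symm⟩
    · rintro ⟨_, ⟨a, ha, rfl⟩, rfl⟩
      exact ⟨_, ⟨a, ha, rfl⟩, a, ha, 𝓖.s_inv a, 𝓖.inv_mul a⟩
  rw [hmul, chainClass_unit hU.isClopen_s] at this
  exact eq_neg_of_add_eq_zero_left this.symm

theorem boundary₁_charFun {U : Set G} (hU : 𝓖.IsCompactOpenGSet U) :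
    𝓖.boundary₁ (charFun U hU.isCompact hU.isOpen) =
      charFun (𝓖.s '' U) (hU.isCompact.image continuous_s) hU.isClopen_s.isOpen -
      charFun (𝓖.r '' U) (hU.isCompact.image continuous_r) hU.isClopen_r.isOpen := by
  rw [boundary₁, AddMonoidHom.sub_apply, pushforward_charFun _ _ _ hU.injOn_s _ _ rfl,
    pushforward_charFun _ _ _ hU.injOn_r _ _ rfl]

/-- Modulo `im ∂₂`, every chain is a sum of characteristic functions of `𝓖`-sets. -/
theorem exists_sum_chainClass [CompactSpace X] [TotallyDisconnectedSpace X] (f : C_c(G, ℤ)) :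
    ∃ (ι : Type) (_ : Fintype ι) (U : ι → Set G), (∀ i, 𝓖.IsCompactOpenGSet (U i)) ∧
      QuotientAddGroup.mk f = ∑ i, 𝓖.chainClass (U i) ∧
      ∀ x, 𝓖.boundary₁ f x =
        ∑ i, ((𝓖.s '' U i).indicator 1 x - (𝓖.r '' U i).indicator 1 x) := by
  -- Negatives are realised by replacing `U i` with its inverse, which represents the same class but
  -- not the same chain. Carrying the formula for `∂₁ f` along keeps control of the boundary without
  -- appeal to `∂₁ ∂₂ = 0`.
  let S : AddSubgroup C_c(G, ℤ) :=
    { carrier := {f | ∃ (ι : Type) (_ : Fintype ι) (U : ι → Set G),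
        (∀ i, 𝓖.IsCompactOpenGSet (U i)) ∧ QuotientAddGroup.mk f = ∑ i, 𝓖.chainClass (U i) ∧
        ∀ x, 𝓖.boundary₁ f x =
          ∑ i, ((𝓖.s '' U i).indicator 1 x - (𝓖.r '' U i).indicator 1 x)}
      zero_mem' := ⟨Empty, inferInstance, Empty.elim, by simp, by simp, by simp⟩
      add_mem' := by
        rintro f g ⟨ι, _, U, hU, h1, h2⟩ ⟨κ, _, V, hV, h3, h4⟩
        refine ⟨ι ⊕ κ, inferInstance, Sum.elim U V, ?_, ?_, ?_⟩
        · rintro (i | i)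
          exacts [hU i, hV i]
        · simp [h1, h3]
        · intro x
          simp [h2, h4]
          abel
      neg_mem' := by
        rintro f ⟨ι, _, U, hU, h1, h2⟩
        refine ⟨ι, inferInstance, fun i => 𝓖.inv '' U i, fun i => (hU i).inv, ?_, fun x => ?_⟩
        · simp [h1, chainClass_inv (hU _)]
        · simp only [map_neg, CompactlySupportedContinuousMap.coe_neg, Pi.neg_apply, h2,
            image_s_inv, image_r_inv, ← Finset.sum_neg_distrib, neg_sub] }
  refine mem_of_charFun_mem (S := S) (fun g => ?_) f
  obtain ⟨U, hU, hg, -⟩ := exists_isCompactOpenGSet (𝓖 := 𝓖) isOpen_univ (mem_univ g)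
  refine ⟨U, hU.isCompact, hU.isOpen, hg, fun A hA hc ho => ?_⟩
  refine ⟨Unit, inferInstance, fun _ => A, fun _ => hU.subset hA hc ho, ?_, fun x => ?_⟩
  · simp [chainClass_eq hc ho]
  · rw [boundary₁_charFun (hU.subset hA hc ho)]
    simp [charFun_apply]

end ChainClass

end EtaleGroupoid

/-! ### Surjectivity of the index map -/

/-- Two finite families of clopen sets which cover every point equally often have a common
refinement. -/
theorem exists_clopen_refinement {X ι : Type*} [TopologicalSpace X] [Finite ι] {R S : ι → Set X}
    (hR : ∀ i, IsClopen (R i)) (hS : ∀ i, IsClopen (S i))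
    (h : ∀ x, {i | x ∈ R i}.ncard = {i | x ∈ S i}.ncard) :
    ∃ C : ι → ι → Set X, (∀ i j, IsClopen (C i j)) ∧
      (∀ i, Pairwise fun j k => Disjoint (C i j) (C i k)) ∧ (∀ i, ⋃ j, C i j = R i) ∧
      (∀ j, Pairwise fun i k => Disjoint (C i j) (C k j)) ∧ (∀ j, ⋃ i, C i j = S j) := by
  classical
  cases nonempty_fintype ι
  -- A bijection between the indices covering a point on the two sides is extended to a permutation
  -- of `ι`, chosen once for each pair of membership patterns. Patterns of different size never
  -- occur at a point and get the default value `1`.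
  have hperm : ∀ a b : ι → Bool, ∃ e : Equiv.Perm ι,
      {i | a i = true}.ncard = {i | b i = true}.ncard → ∀ i, b (e i) = a i := by
    intro a b
    by_cases hab : {i | a i = true}.ncard = {i | b i = true}.ncard
    · have e : {i // a i = true} ≃ {i // b i = true} :=
        Fintype.equivOfCardEq (by
          rw [← Nat.card_eq_fintype_card, ← Nat.card_eq_fintype_card]
          exact hab)
      refine ⟨e.extendSubtype, fun _ i => ?_⟩
      by_cases hi : a i = true
      · rw [hi]
        exact e.extendSubtype_mem i hi
      · rw [Bool.not_eq_true] at hi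
        rw [hi]
        exact Bool.not_eq_true _ ▸ e.extendSubtype_not_mem i (by simp [hi])
    · exact ⟨1, fun h => absurd h hab⟩
  choose e he using hperm
  let a : X → ι → Bool := fun x i => decide (x ∈ R i)
  let b : X → ι → Bool := fun x i => decide (x ∈ S i)
  have ha : Continuous a := continuous_pi fun i => by
    convert (continuous_boolIndicator_iff_isClopen (R i)).2 (hR i) using 1
    ext x
    simp [a, boolIndicator]
  have hb : Continuous b := continuous_pi fun i => by
    convert (continuous_boolIndicator_iff_isClopen (S i)).2 (hS i) using 1
    ext x
    simp [b, boolIndicator]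
  have hab : ∀ x i, e (a x) (b x) i ∈ {j | x ∈ S j} ↔ x ∈ R i := fun x i => by
    have := he (a x) (b x) (by simpa [a, b] using h x) i
    simpa [a, b] using this
  -- The permutation at `x` depends only on the patterns `a x` and `b x`, which vary continuously in
  -- a finite discrete space; hence these sets are clopen.
  refine ⟨fun i j => {x | x ∈ R i ∧ e (a x) (b x) i = j}, fun i j => (hR i).inter ?_, ?_, ?_, ?_,
    ?_⟩
  · exact (isClopen_discrete {p : (ι → Bool) × (ι → Bool) | e p.1 p.2 i = j}).preimage
      (ha.prodMk hb)
  · rintro i j k hjk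
    rw [disjoint_left]
    rintro x ⟨_, rfl⟩ ⟨_, rfl⟩
    exact hjk rfl
  · intro i
    ext x
    simp
  · rintro j i k hik
    rw [disjoint_left]
    rintro x ⟨_, rfl⟩ ⟨_, h⟩
    exact hik ((e (a x) (b x)).injective h.symm)
  · intro j
    ext x
    simp only [mem_iUnion, mem_ofPred_eq]
    constructor
    · rintro ⟨i, hi, rfl⟩
      exact (hab x i).2 hi
    · intro hx
      refine ⟨(e (a x) (b x)).symm j, ?_, Equiv.apply_symm_apply _ _⟩
      rw [← hab, Equiv.apply_symm_apply]
      exact hx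

namespace EtaleGroupoid

section Surjectivity

variable {X G : Type*} [TopologicalSpace X] [TopologicalSpace G]
  [SecondCountableTopology G] [LocallyCompactSpace G] [T2Space G] {𝓖 : EtaleGroupoid X G}

theorem IsCompactOpenGSet.disjoint_image_r_restrict {W : Set G} (hW : 𝓖.IsCompactOpenGSet W)
    {A B : Set X} (h : Disjoint A B) :
    Disjoint (𝓖.r '' (W ∩ 𝓖.s ⁻¹' A)) (𝓖.r '' (W ∩ 𝓖.s ⁻¹' B)) := by
  rw [disjoint_left]
  rintro _ ⟨g, ⟨hg, hgA⟩, rfl⟩ ⟨g', ⟨hg', hgB⟩, e⟩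
  obtain rfl := hW.injOn_r hg' hg e
  exact disjoint_left.1 h hgA hgB

theorem chainClass_restrict_iUnion {ι : Type*} [Fintype ι] {W : Set G}
    (hW : 𝓖.IsCompactOpenGSet W) {C : ι → Set X} (hC : ∀ i, IsClopen (C i))
    (hd : Pairwise fun i j => Disjoint (C i) (C j)) :
    𝓖.chainClass (W ∩ 𝓖.s ⁻¹' ⋃ i, C i) = ∑ i, 𝓖.chainClass (W ∩ 𝓖.s ⁻¹' C i) := by
  rw [preimage_iUnion, inter_iUnion]
  exact chainClass_iUnion (fun i => hW.restrict (hC i)) fun i j hij =>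
    (hW.disjoint_image_r_restrict (hd hij)).of_image

/-- The generators `U i` of a cycle may overlap, but after conjugation into disjoint copies of the
unit space they form one `𝓖`-set, whose range can be moved back onto its source because the chain is
a cycle. -/
theorem indexMap_surjective [T2Space X] [CompactSpace X] [TotallyDisconnectedSpace X]
    (hep : 𝓖.IsEssentiallyPrincipal) (hpi : 𝓖.IsPurelyInfinite) :
    Function.Surjective (𝓖.indexMap hep) := by
  intro y
  obtain ⟨⟨f, hf⟩, hfy⟩ := QuotientAddGroup.mk_surjective y.toAdd
  obtain ⟨ι, _, U, hU, hfU, hbd⟩ := exists_sum_chainClass (𝓖 := 𝓖) f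
  obtain ⟨W₀, hW₀, hWs₀, -, hWd₀⟩ := (hpi univ isClopen_univ).exists_seq
  obtain ⟨W, hW, hWs, hWd⟩ : ∃ W : ι → Set G, (∀ i, 𝓖.IsCompactOpenGSet (W i)) ∧
      (∀ i, 𝓖.s '' W i = univ) ∧ Pairwise fun i j => Disjoint (𝓖.r '' W i) (𝓖.r '' W j) :=
    ⟨fun i => W₀ (Fintype.equivFin ι i), fun i => hW₀ _, fun i => hWs₀ _, fun i j hij =>
      hWd₀ (fun h => hij ((Fintype.equivFin ι).injective (Fin.ext h)))⟩
  -- `T i A` carries `A` onto its image in the `i`-th copy of the unit space.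
  let T : ι → Set X → Set G := fun i A => W i ∩ 𝓖.s ⁻¹' A
  have hT : ∀ i {A}, IsClopen A → 𝓖.IsCompactOpenGSet (T i A) := fun i _ hA => (hW i).restrict hA
  have hTs : ∀ i A, 𝓖.s '' T i A = A := fun i A => by
    rw [image_s_restrict, hWs, univ_inter]
  have hTd : ∀ {i j} A B, i ≠ j → Disjoint (𝓖.r '' T i A) (𝓖.r '' T j B) := fun A B hij =>
    (hWd hij).mono (image_mono inter_subset_left) (image_mono inter_subset_left)
  have hTd' : ∀ i {A B}, Disjoint A B → Disjoint (𝓖.r '' T i A) (𝓖.r '' T i B) :=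
    fun i _ _ h => (hW i).disjoint_image_r_restrict h
  have hTr : ∀ i (C : ι → Set X), 𝓖.r '' T i (⋃ j, C j) = ⋃ j, 𝓖.r '' T i (C j) := fun i C => by
    rw [← image_iUnion]
    simp only [T, preimage_iUnion, inter_iUnion]
  -- Evaluating `∂₁ f = 0` at `x` says that `x` lies in as many of the ranges as of the sources. The
  -- set `C i j` is the part of `r(U i)` matched with `s(U j)`.
  obtain ⟨C, hC, hCd, hCR, hCd', hCS⟩ := exists_clopen_refinement
    (R := fun i => 𝓖.r '' U i) (S := fun i => 𝓖.s '' U i) (fun i => (hU i).isClopen_r)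
    (fun i => (hU i).isClopen_s) (fun x => by
      classical
      have h := hbd x
      have hz : 𝓖.boundary₁ f = 0 := hf
      rw [hz, Finset.sum_sub_distrib] at h
      have aux : ∀ A : ι → Set X,
          ∑ i, (A i).indicator (1 : X → ℤ) x = ({i | x ∈ A i}.ncard : ℤ) := fun A => by
        simp only [indicator_apply, Pi.one_apply, Finset.sum_boole]
        rw [ncard_eq_toFinset_card', toFinset_ofPred]
      rw [aux, aux] at h
      have h0 : (0 : C_c(X, ℤ)) x = 0 := rfl
      rw [h0] at h
      omega)
  have hI : ∀ i {A}, IsClopen A → 𝓖.IsCompactOpenGSet (𝓖.inv '' T i A) := fun i _ hA =>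
    (hT i hA).inv
  -- the conjugates of the given sets, with disjoint sources and disjoint ranges
  let V : ι → Set G := fun i =>
    𝓖.setMul (T i (𝓖.r '' U i)) (𝓖.setMul (U i) (𝓖.inv '' T i (𝓖.s '' U i)))
  have hUI : ∀ i, 𝓖.s '' U i = 𝓖.r '' (𝓖.inv '' T i (𝓖.s '' U i)) := fun i => by
    rw [image_r_inv, hTs]
  have hTU : ∀ i, 𝓖.s '' T i (𝓖.r '' U i) =
      𝓖.r '' 𝓖.setMul (U i) (𝓖.inv '' T i (𝓖.s '' U i)) := fun i => by
    rw [hTs, image_r_setMul (hUI i).le]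
  have hV : ∀ i, 𝓖.IsCompactOpenGSet (V i) := fun i =>
    (hT i (hU i).isClopen_r).mul ((hU i).mul (hI i (hU i).isClopen_s))
  have hVr : ∀ i, 𝓖.r '' V i = 𝓖.r '' T i (𝓖.r '' U i) := fun i => image_r_setMul (hTU i).le
  have hVs : ∀ i, 𝓖.s '' V i = 𝓖.r '' T i (𝓖.s '' U i) := fun i => by
    rw [image_s_setMul (hTU i).ge, image_s_setMul (hUI i).ge, image_s_inv]
  have hVc : ∀ i, 𝓖.chainClass (V i) = 𝓖.chainClass (T i (𝓖.r '' U i)) +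
      (𝓖.chainClass (U i) - 𝓖.chainClass (T i (𝓖.s '' U i))) := fun i => by
    rw [chainClass_setMul (hT i (hU i).isClopen_r) ((hU i).mul (hI i (hU i).isClopen_s)) (hTU i),
      chainClass_setMul (hU i) (hI i (hU i).isClopen_s) (hUI i),
      chainClass_inv (hT i (hU i).isClopen_s), sub_eq_add_neg]
  have hVrd : Pairwise fun i j => Disjoint (𝓖.r '' V i) (𝓖.r '' V j) := fun i j hij => by
    change Disjoint _ _
    rw [hVr, hVr]
    exact hTd _ _ hij
  have hVsd : Pairwise fun i j => Disjoint (𝓖.s '' V i) (𝓖.s '' V j) := fun i j hij => by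
    change Disjoint _ _
    rw [hVs, hVs]
    exact hTd _ _ hij
  have hVV := IsCompactOpenGSet.iUnion hV hVrd hVsd
  have hVVs : 𝓖.s '' (⋃ i, V i) = ⋃ i, 𝓖.r '' T i (𝓖.s '' U i) := by
    rw [image_iUnion]
    exact iUnion_congr hVs
  have hVVr : 𝓖.r '' (⋃ i, V i) = ⋃ i, 𝓖.r '' T i (𝓖.r '' U i) := by
    rw [image_iUnion]
    exact iUnion_congr hVr
  -- the rearrangement which makes source and range equal
  let K : ι × ι → Set G := fun p => 𝓖.setMul (T p.2 (C p.1 p.2)) (𝓖.inv '' T p.1 (C p.1 p.2))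
  have hTI : ∀ p : ι × ι, 𝓖.s '' T p.2 (C p.1 p.2) = 𝓖.r '' (𝓖.inv '' T p.1 (C p.1 p.2)) :=
    fun p => by rw [image_r_inv, hTs, hTs]
  have hK : ∀ p, 𝓖.IsCompactOpenGSet (K p) := fun p => (hT _ (hC _ _)).mul (hI _ (hC _ _))
  have hKr : ∀ p, 𝓖.r '' K p = 𝓖.r '' T p.2 (C p.1 p.2) := fun p => image_r_setMul (hTI p).le
  have hKs : ∀ p, 𝓖.s '' K p = 𝓖.r '' T p.1 (C p.1 p.2) := fun p => by
    rw [image_s_setMul (hTI p).ge, image_s_inv]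
  have hKc : ∀ p, 𝓖.chainClass (K p) =
      𝓖.chainClass (T p.2 (C p.1 p.2)) - 𝓖.chainClass (T p.1 (C p.1 p.2)) := fun p => by
    rw [chainClass_setMul (hT _ (hC _ _)) (hI _ (hC _ _)) (hTI p), chainClass_inv (hT _ (hC _ _)),
      sub_eq_add_neg]
  have hKrd : Pairwise fun p q => Disjoint (𝓖.r '' K p) (𝓖.r '' K q) := fun p q hpq => by
    change Disjoint _ _
    rw [hKr, hKr]
    by_cases h : p.2 = q.2
    · rw [h]
      exact hTd' _ (hCd' _ fun h' => hpq (Prod.ext h' h))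
    · exact hTd _ _ h
  have hKsd : Pairwise fun p q => Disjoint (𝓖.s '' K p) (𝓖.s '' K q) := fun p q hpq => by
    change Disjoint _ _
    rw [hKs, hKs]
    by_cases h : p.1 = q.1
    · rw [h]
      exact hTd' _ (hCd _ fun h' => hpq (Prod.ext h h'))
    · exact hTd _ _ h
  have hKK := IsCompactOpenGSet.iUnion hK hKrd hKsd
  have hKKs : 𝓖.s '' (⋃ p, K p) = 𝓖.r '' (⋃ i, V i) := by
    rw [hVVr, image_iUnion, iUnion_prod']
    refine iUnion_congr fun i => ?_
    rw [← hCR, hTr]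
    exact iUnion_congr fun j => hKs (i, j)
  have hKKr : 𝓖.r '' (⋃ p, K p) = 𝓖.s '' (⋃ i, V i) := by
    rw [hVVs, image_iUnion, iUnion_prod', iUnion_comm]
    refine iUnion_congr fun j => ?_
    rw [← hCS, hTr]
    exact iUnion_congr fun i => hKr (i, j)
  let Z : Set G := 𝓖.setMul (⋃ p, K p) (⋃ i, V i)
  have hZ : 𝓖.IsCompactOpenGSet Z := hKK.mul hVV
  have hZs : 𝓖.s '' Z = 𝓖.s '' (⋃ i, V i) := image_s_setMul hKKs.ge
  have hZr : 𝓖.r '' Z = 𝓖.s '' (⋃ i, V i) := (image_r_setMul hKKs.le).trans hKKr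
  -- Conjugation adds `[T i (r(U i))] - [T i (s(U i))]` for each `i`, and the pieces `K` contribute
  -- `[T j (C i j)] - [T i (C i j)]`. Summed over the refinement, these cancel.
  have hZc : 𝓖.chainClass Z = QuotientAddGroup.mk f := by
    have hR : ∀ i, 𝓖.chainClass (T i (𝓖.r '' U i)) = ∑ j, 𝓖.chainClass (T i (C i j)) :=
      fun i => by rw [← hCR]; exact chainClass_restrict_iUnion (hW i) (hC i) (hCd i)
    have hS : ∀ j, 𝓖.chainClass (T j (𝓖.s '' U j)) = ∑ i, 𝓖.chainClass (T j (C i j)) :=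
      fun j => by
        rw [← hCS]
        exact chainClass_restrict_iUnion (hW j) (fun i => hC i j) (hCd' j)
    have hswap : ∑ i, 𝓖.chainClass (T i (𝓖.s '' U i)) =
        ∑ i, ∑ j, 𝓖.chainClass (T j (C i j)) := by
      rw [Finset.sum_comm]
      exact Finset.sum_congr rfl fun j _ => hS j
    rw [chainClass_setMul hKK hVV hKKs,
      chainClass_iUnion hK fun p q h => (hKrd h).of_image,
      chainClass_iUnion hV fun p q h => (hVrd h).of_image, hfU, Fintype.sum_prod_type]
    simp only [hKc, hVc, Finset.sum_add_distrib, Finset.sum_sub_distrib, hswap, hR]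
    abel
  have hD : IsClopen (𝓖.s '' (⋃ i, V i)) := hVV.isClopen_s
  -- Outside the common source and range of `Z` units are added; they have class zero.
  have hE := IsCompactOpenGSet.image_unit 𝓖 hD.compl.isClosed.isCompact hD.compl.isOpen
  have hZr' : Disjoint (𝓖.r '' Z) (𝓖.r '' (𝓖.unit '' (𝓖.s '' (⋃ i, V i))ᶜ)) := by
    rw [hZr, image_r_unit]
    exact disjoint_compl_right
  have hZs' : Disjoint (𝓖.s '' Z) (𝓖.s '' (𝓖.unit '' (𝓖.s '' (⋃ i, V i))ᶜ)) := by
    rw [hZs, image_s_unit]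
    exact disjoint_compl_right
  have hF := hZ.union hE hZr' hZs'
  have hFs : 𝓖.s '' (Z ∪ 𝓖.unit '' (𝓖.s '' (⋃ i, V i))ᶜ) = univ := by
    rw [image_union, hZs, image_s_unit, union_compl_self]
  have hFr : 𝓖.r '' (Z ∪ 𝓖.unit '' (𝓖.s '' (⋃ i, V i))ᶜ) = univ := by
    rw [image_union, hZr, image_r_unit, union_compl_self]
  have hFc : 𝓖.chainClass (Z ∪ 𝓖.unit '' (𝓖.s '' (⋃ i, V i))ᶜ) = QuotientAddGroup.mk f := by
    rw [chainClass_union hZ hE hZs'.of_image, hZc, chainClass_unit hD.compl, add_zero]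
  refine ⟨𝓖.ofGSet _ hF hFs hFr, ?_⟩
  rw [𝓖.indexMap_apply hep _ hF (𝓖.isTheta_ofGSet hF hFs hFr)]
  change Multiplicative.ofAdd _ = Multiplicative.ofAdd y.toAdd
  rw [← hfy, cycleClass]
  refine congrArg Multiplicative.ofAdd (QuotientAddGroup.eq.2 ?_)
  rw [AddSubgroup.mem_addSubgroupOf]
  rw [chainClass_eq hF.isCompact hF.isOpen] at hFc
  exact QuotientAddGroup.eq.1 hFc

end Surjectivity

end EtaleGroupoid

/-! ### Swaps and their classes in the abelianization -/

/-- Without isolated points, a non-empty open set has two distinct points, and a clopen set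
separates them. -/
theorem IsOpen.exists_isClopen_split {X : Type*} [TopologicalSpace X] [CompactSpace X] [T2Space X]
    [TotallyDisconnectedSpace X] [PerfectSpace X] {A : Set X} (hA : IsOpen A)
    (hne : A.Nonempty) : ∃ B, IsClopen B ∧ (A ∩ B).Nonempty ∧ (A \ B).Nonempty := by
  obtain ⟨x, hx⟩ := hne
  obtain ⟨y, hyA, hyx⟩ : (A ∩ {x}ᶜ).Nonempty :=
    (inferInstance : NeBot (𝓝[≠] x)).nonempty_of_mem
      (inter_mem (mem_nhdsWithin_of_mem_nhds (hA.mem_nhds hx)) self_mem_nhdsWithin)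
  obtain ⟨B, hB, hxB, hBy⟩ := compact_exists_isClopen_in_isOpen (isOpen_compl_singleton (x := y))
    (show x ∈ ({y}ᶜ : Set X) from fun h => hyx h.symm)
  exact ⟨B, hB, ⟨x, hx, hxB⟩, ⟨y, hyA, fun h => hBy h rfl⟩⟩

namespace EtaleGroupoid

section Swaps

variable {X G : Type*} [TopologicalSpace X] [TopologicalSpace G]
  [SecondCountableTopology G] [LocallyCompactSpace G] [T2Space G] (𝓖 : EtaleGroupoid X G)

/-- `U` is a compact open `𝓖`-set with `r(U) ∩ s(U) = ∅`, so that `τ_U` is defined. -/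
structure IsSwapSet (U : Set G) : Prop where
  isCompactOpenGSet : 𝓖.IsCompactOpenGSet U
  disjoint : 𝓖.r '' U ∩ 𝓖.s '' U = ∅

variable {𝓖}

namespace IsSwapSet

theorem r_ne_s {U : Set G} (hU : 𝓖.IsSwapSet U) {g h : G} (hg : g ∈ U) (hh : h ∈ U) :
    𝓖.r g ≠ 𝓖.s h := fun e =>
  (hU.disjoint.le ⟨⟨g, hg, rfl⟩, ⟨h, hh, e.symm⟩⟩ : 𝓖.r g ∈ (∅ : Set X))

theorem inv {U : Set G} (hU : 𝓖.IsSwapSet U) : 𝓖.IsSwapSet (𝓖.inv '' U) :=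
  ⟨hU.1.inv, by rw [image_r_inv, image_s_inv, inter_comm, hU.2]⟩

theorem restrict {U : Set G} (hU : 𝓖.IsSwapSet U) {A : Set X} (hA : IsClopen A) :
    𝓖.IsSwapSet (U ∩ 𝓖.s ⁻¹' A) :=
  ⟨hU.1.restrict hA, subset_empty_iff.1 (hU.2 ▸ inter_subset_inter
    (image_mono inter_subset_left) (image_mono inter_subset_left))⟩

end IsSwapSet

theorem isSwapSet_empty : 𝓖.IsSwapSet ∅ := ⟨isCompactOpenGSet_empty, by simp⟩

theorem IsSwapFamily.isSwapSet {n : ℕ} {A : Set X} {U : Fin n → Set G}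
    (h : 𝓖.IsSwapFamily A U) (i : Fin n) : 𝓖.IsSwapSet (U i) :=
  ⟨h.isCompactOpenGSet i, h.disjoint_range_source i⟩

variable [CompactSpace X] [T2Space X]

theorem eq_swap {U : Set G} (hU : 𝓖.IsSwapSet U) {α : 𝓖.fullGroup}
    (hs : ∀ g ∈ U, α.1 (𝓖.s g) = 𝓖.r g) (hr : ∀ g ∈ U, α.1 (𝓖.r g) = 𝓖.s g)
    (h : ∀ x ∉ 𝓖.s '' U ∪ 𝓖.r '' U, α.1 x = x) : α = 𝓖.swap U hU.1 hU.2 := by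
  refine Subtype.ext (Homeomorph.ext fun x => ?_)
  by_cases hx : x ∈ 𝓖.s '' U ∪ 𝓖.r '' U
  · obtain ⟨g, hg, rfl⟩ | ⟨g, hg, rfl⟩ := hx
    · rw [hs g hg, 𝓖.swap_s hU.1 hU.2 hg]
    · rw [hr g hg, 𝓖.swap_r hU.1 hU.2 hg]
  · rw [h x hx, 𝓖.swap_of_notMem hU.1 hU.2 hx]

theorem fullGroup_mul_apply (α β : 𝓖.fullGroup) (x : X) : (α * β).1 x = α.1 (β.1 x) := rfl

theorem fullGroup_inv_apply (α : 𝓖.fullGroup) {x y : X} (h : α.1 x = y) : (α⁻¹).1 y = x := by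
  rw [← h]
  exact α.1.symm_apply_apply x

theorem swap_mul_self {U : Set G} (hU : 𝓖.IsSwapSet U) :
    𝓖.swap U hU.1 hU.2 * 𝓖.swap U hU.1 hU.2 = 1 := by
  refine Subtype.ext (Homeomorph.ext fun x => ?_)
  rw [fullGroup_mul_apply]
  by_cases hx : x ∈ 𝓖.s '' U ∪ 𝓖.r '' U
  · obtain ⟨g, hg, rfl⟩ | ⟨g, hg, rfl⟩ := hx
    · rw [𝓖.swap_s hU.1 hU.2 hg, 𝓖.swap_r hU.1 hU.2 hg]
      rfl
    · rw [𝓖.swap_r hU.1 hU.2 hg, 𝓖.swap_s hU.1 hU.2 hg]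
      rfl
  · rw [𝓖.swap_of_notMem hU.1 hU.2 hx, 𝓖.swap_of_notMem hU.1 hU.2 hx]
    rfl

theorem isTransposition_swap {U : Set G} (hU : 𝓖.IsSwapSet U) :
    𝓖.IsTransposition (𝓖.swap U hU.1 hU.2) := by
  refine ⟨by rw [pow_two, swap_mul_self hU], ?_⟩
  convert (hU.1.isClopen_s.union hU.1.isClopen_r).compl using 1
  ext x
  refine ⟨fun hx => ?_, fun hx => 𝓖.swap_of_notMem hU.1 hU.2 hx⟩
  rintro (⟨g, hg, rfl⟩ | ⟨g, hg, rfl⟩)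
  · exact hU.r_ne_s hg hg ((𝓖.swap_s hU.1 hU.2 hg).symm.trans hx)
  · exact hU.r_ne_s hg hg ((𝓖.swap_r hU.1 hU.2 hg).symm.trans hx).symm

/-- That `U ∪ V` is itself a swap set forces the supports of `τ_U` and `τ_V` to be disjoint. -/
theorem swap_union {U V : Set G} (hU : 𝓖.IsSwapSet U) (hV : 𝓖.IsSwapSet V)
    (hUV : 𝓖.IsSwapSet (U ∪ V)) (hd : Disjoint U V) :
    𝓖.swap U hU.1 hU.2 * 𝓖.swap V hV.1 hV.2 = 𝓖.swap (U ∪ V) hUV.1 hUV.2 := by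
  have hs : ∀ g ∈ U, ∀ h ∈ V, 𝓖.s g ≠ 𝓖.s h := fun g hg h hh e =>
    disjoint_left.1 hd hg (hUV.1.injOn_s (Or.inl hg) (Or.inr hh) e ▸ hh)
  have hr : ∀ g ∈ U, ∀ h ∈ V, 𝓖.r g ≠ 𝓖.r h := fun g hg h hh e =>
    disjoint_left.1 hd hg (hUV.1.injOn_r (Or.inl hg) (Or.inr hh) e ▸ hh)
  have hrs : ∀ g ∈ U, ∀ h ∈ V, 𝓖.r g ≠ 𝓖.s h := fun g hg h hh =>
    hUV.r_ne_s (Or.inl hg) (Or.inr hh)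
  have hsr : ∀ g ∈ U, ∀ h ∈ V, 𝓖.r h ≠ 𝓖.s g := fun g hg h hh =>
    hUV.r_ne_s (Or.inr hh) (Or.inl hg)
  refine eq_swap hUV ?_ ?_ ?_
  · rintro g (hg | hg)
    · rw [fullGroup_mul_apply, 𝓖.swap_of_notMem hV.1 hV.2, 𝓖.swap_s hU.1 hU.2 hg]
      rintro (⟨h, hh, e⟩ | ⟨h, hh, e⟩)
      exacts [hs g hg h hh e.symm, hsr g hg h hh e]
    · rw [fullGroup_mul_apply, 𝓖.swap_s hV.1 hV.2 hg, 𝓖.swap_of_notMem hU.1 hU.2]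
      rintro (⟨h, hh, e⟩ | ⟨h, hh, e⟩)
      exacts [hsr h hh g hg e.symm, hr h hh g hg e]
  · rintro g (hg | hg)
    · rw [fullGroup_mul_apply, 𝓖.swap_of_notMem hV.1 hV.2, 𝓖.swap_r hU.1 hU.2 hg]
      rintro (⟨h, hh, e⟩ | ⟨h, hh, e⟩)
      exacts [hrs g hg h hh e.symm, hr g hg h hh e.symm]
    · rw [fullGroup_mul_apply, 𝓖.swap_r hV.1 hV.2 hg, 𝓖.swap_of_notMem hU.1 hU.2]
      rintro (⟨h, hh, e⟩ | ⟨h, hh, e⟩)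
      exacts [hs h hh g hg e, hrs h hh g hg e]
  · intro x hx
    rw [image_union, image_union] at hx
    rw [fullGroup_mul_apply, 𝓖.swap_of_notMem hV.1 hV.2 fun h => hx (h.imp Or.inr Or.inr),
      𝓖.swap_of_notMem hU.1 hU.2 fun h => hx (h.imp Or.inl Or.inl)]

/-- Conjugation by the swap of two disjoint ranges exchanges swaps with the same source. -/
theorem exists_conj_swap_eq {U V : Set G} (hU : 𝓖.IsSwapSet U) (hV : 𝓖.IsSwapSet V)
    (hs : 𝓖.s '' U = 𝓖.s '' V) (hr : Disjoint (𝓖.r '' U) (𝓖.r '' V)) :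
    ∃ σ : 𝓖.fullGroup, σ * 𝓖.swap U hU.1 hU.2 * σ⁻¹ = 𝓖.swap V hV.1 hV.2 := by
  -- The conjugator is `τ_W` for `W = V U⁻¹`, which exchanges `r(U)` with `r(V)`. It fixes the
  -- common source pointwise, since that is disjoint from both ranges.
  have hVU : 𝓖.s '' V = 𝓖.r '' (𝓖.inv '' U) := by rw [image_r_inv, hs]
  have hWs : 𝓖.s '' 𝓖.setMul V (𝓖.inv '' U) = 𝓖.r '' U := by
    rw [image_s_setMul hVU.ge, image_s_inv]
  have hWr : 𝓖.r '' 𝓖.setMul V (𝓖.inv '' U) = 𝓖.r '' V := image_r_setMul hVU.le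
  have hW : 𝓖.IsSwapSet (𝓖.setMul V (𝓖.inv '' U)) :=
    ⟨hV.1.mul hU.1.inv, by rw [hWs, hWr, ← disjoint_iff_inter_eq_empty]; exact hr.symm⟩
  have hσ : ∀ g ∈ U, ∀ h ∈ V, 𝓖.s g = 𝓖.s h →
      (𝓖.swap _ hW.1 hW.2).1 (𝓖.r g) = 𝓖.r h ∧ (𝓖.swap _ hW.1 hW.2).1 (𝓖.r h) = 𝓖.r g := by
    intro g hg h hh e
    have hk : 𝓖.mul h (𝓖.inv g) (e.symm.trans (𝓖.r_inv g).symm) ∈ 𝓖.setMul V (𝓖.inv '' U) :=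
      ⟨h, hh, _, ⟨g, hg, rfl⟩, _, rfl⟩
    have h1 := 𝓖.swap_s hW.1 hW.2 hk
    have h2 := 𝓖.swap_r hW.1 hW.2 hk
    rw [𝓖.s_mul, 𝓖.r_mul, 𝓖.s_inv] at h1 h2
    exact ⟨h1, h2⟩
  have hσ' : ∀ x, x ∉ 𝓖.r '' U → x ∉ 𝓖.r '' V → (𝓖.swap _ hW.1 hW.2).1 x = x := by
    intro x h1 h2
    refine 𝓖.swap_of_notMem hW.1 hW.2 ?_
    rw [hWs, hWr]
    rintro (h | h)
    exacts [h1 h, h2 h]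
  have hσs : ∀ h ∈ V, (𝓖.swap _ hW.1 hW.2).1 (𝓖.s h) = 𝓖.s h := by
    intro h hh
    refine hσ' _ ?_ ?_
    · rintro ⟨g, hg, e⟩
      obtain ⟨g', hg', e'⟩ := hs.ge ⟨h, hh, rfl⟩
      exact hU.r_ne_s hg hg' (e.trans e'.symm)
    · rintro ⟨g, hg, e⟩
      exact hV.r_ne_s hg hh e
  refine ⟨𝓖.swap _ hW.1 hW.2, eq_swap hV ?_ ?_ ?_⟩
  · intro h hh
    obtain ⟨g, hg, e⟩ := hs.ge ⟨h, hh, rfl⟩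
    rw [fullGroup_mul_apply, fullGroup_mul_apply, fullGroup_inv_apply _ (hσs h hh), ← e,
      𝓖.swap_s hU.1 hU.2 hg, (hσ g hg h hh e).1]
  · intro h hh
    obtain ⟨g, hg, e⟩ := hs.ge ⟨h, hh, rfl⟩
    rw [fullGroup_mul_apply, fullGroup_mul_apply, fullGroup_inv_apply _ (hσ g hg h hh e).1,
      𝓖.swap_r hU.1 hU.2 hg, e, hσs h hh]
  · intro x hx
    rw [fullGroup_mul_apply, fullGroup_mul_apply]
    by_cases hxU : x ∈ 𝓖.r '' U
    · obtain ⟨g, hg, rfl⟩ := hxU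
      obtain ⟨h, hh, e⟩ := hs.le ⟨g, hg, rfl⟩
      rw [fullGroup_inv_apply _ (hσ g hg h hh e.symm).2, 𝓖.swap_of_notMem hU.1 hU.2,
        (hσ g hg h hh e.symm).2]
      rintro (h' | h')
      · rw [hs] at h'
        exact (hV.disjoint.le ⟨⟨h, hh, rfl⟩, h'⟩ : 𝓖.r h ∈ (∅ : Set X))
      · exact disjoint_left.1 hr h' ⟨h, hh, rfl⟩
    · have hσx := hσ' x hxU fun h => hx (Or.inr h)
      rw [fullGroup_inv_apply _ hσx, 𝓖.swap_of_notMem hU.1 hU.2, hσx]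
      rintro (h | h)
      · exact hx (Or.inl (hs ▸ h))
      · exact hxU h

variable (𝓖) in
open Classical in
/-- The class of `τ_U` in `[[𝓖]]_ab` (and zero if `τ_U` is not defined). -/
noncomputable def swapClass (U : Set G) : Additive (Abelianization 𝓖.fullGroup) :=
  if h : 𝓖.IsSwapSet U then Additive.ofMul (Abelianization.of (𝓖.swap U h.1 h.2)) else 0

theorem swapClass_eq {U : Set G} (hU : 𝓖.IsSwapSet U) :
    𝓖.swapClass U = Additive.ofMul (Abelianization.of (𝓖.swap U hU.1 hU.2)) :=
  dif_pos hU

theorem swapClass_add_self (U : Set G) : 𝓖.swapClass U + 𝓖.swapClass U = 0 := by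
  by_cases hU : 𝓖.IsSwapSet U
  · rw [swapClass_eq hU, ← ofMul_mul, ← map_mul, swap_mul_self hU, map_one, ofMul_one]
  · rw [swapClass, dif_neg hU, add_zero]

/-- A swap is symmetric in source and range, so `τ_{U⁻¹} = τ_U`; this later allows a source to be
traded for a range. -/
theorem swapClass_inv {U : Set G} (hU : 𝓖.IsSwapSet U) :
    𝓖.swapClass (𝓖.inv '' U) = 𝓖.swapClass U := by
  rw [swapClass_eq hU, swapClass_eq hU.inv]
  congr 2
  refine eq_swap hU ?_ ?_ ?_
  · intro g hg
    have := 𝓖.swap_r hU.inv.1 hU.inv.2 ⟨g, hg, rfl⟩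
    rwa [𝓖.r_inv, 𝓖.s_inv] at this
  · intro g hg
    have := 𝓖.swap_s hU.inv.1 hU.inv.2 ⟨g, hg, rfl⟩
    rwa [𝓖.r_inv, 𝓖.s_inv] at this
  · intro x hx
    refine 𝓖.swap_of_notMem hU.inv.1 hU.inv.2 ?_
    rwa [image_s_inv, image_r_inv, union_comm]

theorem swapClass_union {U V : Set G} (hU : 𝓖.IsSwapSet U) (hV : 𝓖.IsSwapSet V)
    (hUV : 𝓖.IsSwapSet (U ∪ V)) (hd : Disjoint U V) :
    𝓖.swapClass (U ∪ V) = 𝓖.swapClass U + 𝓖.swapClass V := by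
  rw [swapClass_eq hU, swapClass_eq hV, swapClass_eq hUV, ← swap_union hU hV hUV hd, map_mul,
    ofMul_mul]

theorem swapClass_empty : 𝓖.swapClass ∅ = 0 := by
  have := swapClass_union (𝓖 := 𝓖) isSwapSet_empty isSwapSet_empty
    (by rw [union_self]; exact isSwapSet_empty) (disjoint_empty ∅)
  rwa [union_self, left_eq_add] at this

theorem swapClass_restrict_union {U : Set G} (hU : 𝓖.IsSwapSet U) {A B : Set X} (hA : IsClopen A)
    (hB : IsClopen B) (hd : Disjoint A B) : 𝓖.swapClass (U ∩ 𝓖.s ⁻¹' (A ∪ B)) =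
      𝓖.swapClass (U ∩ 𝓖.s ⁻¹' A) + 𝓖.swapClass (U ∩ 𝓖.s ⁻¹' B) := by
  have h := hU.restrict (hA.union hB)
  rw [preimage_union, inter_union_distrib_left] at h ⊢
  exact swapClass_union (hU.restrict hA) (hU.restrict hB) h
    ((hd.preimage 𝓖.s).mono inter_subset_right inter_subset_right)

theorem swapClass_restrict_iUnion {ι : Type*} [Fintype ι] {U : Set G} (hU : 𝓖.IsSwapSet U)
    {B : ι → Set X} (hB : ∀ i, IsClopen (B i)) (hd : Pairwise fun i j => Disjoint (B i) (B j)) :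
    𝓖.swapClass (U ∩ 𝓖.s ⁻¹' ⋃ i, B i) = ∑ i, 𝓖.swapClass (U ∩ 𝓖.s ⁻¹' B i) := by
  classical
  have key : ∀ F : Finset ι, 𝓖.swapClass (U ∩ 𝓖.s ⁻¹' ⋃ i ∈ F, B i) =
      ∑ i ∈ F, 𝓖.swapClass (U ∩ 𝓖.s ⁻¹' B i) := by
    intro F
    induction F using Finset.induction_on with
    | empty => simp [swapClass_empty]
    | insert i F hi ih =>
      rw [Finset.sum_insert hi, ← ih, Finset.set_biUnion_insert]
      refine swapClass_restrict_union hU (hB i) (isClopen_biUnion_finset fun i _ => hB i) ?_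
      rw [disjoint_iUnion₂_right]
      exact fun j hj => hd fun e => hi (e ▸ hj)
  simpa using key Finset.univ

/-- Conjugate elements agree in the abelianization. -/
theorem swapClass_eq_of_disjoint {U V : Set G} (hU : 𝓖.IsSwapSet U) (hV : 𝓖.IsSwapSet V)
    (hs : 𝓖.s '' U = 𝓖.s '' V) (hr : Disjoint (𝓖.r '' U) (𝓖.r '' V)) :
    𝓖.swapClass U = 𝓖.swapClass V := by
  obtain ⟨σ, hσ⟩ := exists_conj_swap_eq hU hV hs hr
  rw [swapClass_eq hU, swapClass_eq hV, ← hσ]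
  congr 1
  rw [map_mul, map_mul, map_inv, mul_inv_cancel_comm]

variable (𝓖) in
open Classical in
/-- The common class of the products `τ_{U₁} ⋯ τ_{Uₙ}` for which the sources of the `Uᵢ`
partition `A`. -/
noncomputable def sourceClass (A : Set X) : Additive (Abelianization 𝓖.fullGroup) :=
  -- Two sets suffice for every clopen `A` by `exists_isSwapFamily`, and `sum_swapClass_eq` shows
  -- that the choice is immaterial.
  if h : ∃ U : Fin 2 → Set G, 𝓖.IsSwapFamily A U then ∑ i, 𝓖.swapClass (h.choose i) else 0

theorem sourceClass_add_self (A : Set X) : 𝓖.sourceClass A + 𝓖.sourceClass A = 0 := by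
  rw [sourceClass]
  split_ifs
  · rw [← Finset.sum_add_distrib]
    exact Finset.sum_eq_zero fun i _ => swapClass_add_self _
  · exact add_zero 0

variable [TotallyDisconnectedSpace X]

/-- The free space receives a copy of `s(U)` disjoint from both ranges, and the conjugation argument
applies to `U` and to `V` against that copy. -/
theorem swapClass_eq_of_ne_univ (hmin : 𝓖.IsMinimal) (hpi : 𝓖.IsPurelyInfinite) {U V : Set G}
    (hU : 𝓖.IsSwapSet U) (hV : 𝓖.IsSwapSet V) (hs : 𝓖.s '' U = 𝓖.s '' V)
    (hne : (𝓖.s '' U ∪ 𝓖.r '' U ∪ 𝓖.r '' V)ᶜ.Nonempty) : 𝓖.swapClass U = 𝓖.swapClass V := by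
  obtain ⟨W, hW, hWs, hWr⟩ := exists_gset_into hmin hpi hU.1.isClopen_s
    ((hU.1.isClopen_s.union hU.1.isClopen_r).union hV.1.isClopen_r).compl hne
  simp only [compl_union, subset_inter_iff] at hWr
  have hW' : 𝓖.IsSwapSet W := ⟨hW, by
    rw [← disjoint_iff_inter_eq_empty, hWs]
    exact disjoint_compl_left.mono_left hWr.1.1⟩
  rw [swapClass_eq_of_disjoint hU hW' hWs.symm (disjoint_compl_right.mono_right hWr.1.2),
    swapClass_eq_of_disjoint hV hW' (hs.symm.trans hWs.symm)
      (disjoint_compl_right.mono_right hWr.2)]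

/-- The class of `τ_U` in `[[𝓖]]_ab` depends on `s(U)` only. -/
theorem swapClass_eq_of_image_s_eq [PerfectSpace X] (hmin : 𝓖.IsMinimal)
    (hpi : 𝓖.IsPurelyInfinite) {U V : Set G} (hU : 𝓖.IsSwapSet U) (hV : 𝓖.IsSwapSet V)
    (hs : 𝓖.s '' U = 𝓖.s '' V) : 𝓖.swapClass U = 𝓖.swapClass V := by
  rcases (𝓖.s '' U).eq_empty_or_nonempty with he | hne
  · rw [image_eq_empty.1 he, image_eq_empty.1 (hs.symm.trans he)]
  obtain ⟨B, hB, h1, h2⟩ := hU.1.isClopen_s.isOpen.exists_isClopen_split hne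
  -- A point of `s(U) \ C` lies outside the restricted source, and outside `r(U)` and `r(V)` because
  -- these are disjoint from the common source. It is the free point required by
  -- `swapClass_eq_of_ne_univ`.
  have key : ∀ {C : Set X}, IsClopen C → (𝓖.s '' U \ C).Nonempty →
      𝓖.swapClass (U ∩ 𝓖.s ⁻¹' C) = 𝓖.swapClass (V ∩ 𝓖.s ⁻¹' C) := by
    rintro C hC ⟨x, hx, hxC⟩
    refine swapClass_eq_of_ne_univ hmin hpi (hU.restrict hC) (hV.restrict hC)
      (by rw [image_s_restrict, image_s_restrict, hs]) ⟨x, ?_⟩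
    rintro ((h | ⟨g, hg, rfl⟩) | ⟨g, hg, rfl⟩)
    · rw [image_s_restrict] at h
      exact hxC h.2
    · exact (hU.disjoint.le ⟨⟨g, hg.1, rfl⟩, hx⟩ : 𝓖.r g ∈ (∅ : Set X))
    · exact (hV.disjoint.le ⟨⟨g, hg.1, rfl⟩, hs ▸ hx⟩ : 𝓖.r g ∈ (∅ : Set X))
  have hU' := swapClass_restrict_union hU hB hB.compl disjoint_compl_right
  have hV' := swapClass_restrict_union hV hB hB.compl disjoint_compl_right
  rw [union_compl_self, preimage_univ, inter_univ] at hU' hV'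
  rw [hU', hV', key hB h2, key hB.compl (by rwa [Set.sdiff_compl])]

/-- Cut each `U i` along the sources of the `V j` and conversely: the pieces indexed by `(i, j)`
both have source `s(U i) ∩ s(V j)`. -/
theorem sum_swapClass_eq [PerfectSpace X] (hmin : 𝓖.IsMinimal) (hpi : 𝓖.IsPurelyInfinite)
    {ι κ : Type*} [Fintype ι] [Fintype κ] {U : ι → Set G} {V : κ → Set G}
    (hU : ∀ i, 𝓖.IsSwapSet (U i)) (hV : ∀ i, 𝓖.IsSwapSet (V i))
    (hUd : Pairwise fun i j => Disjoint (𝓖.s '' U i) (𝓖.s '' U j))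
    (hVd : Pairwise fun i j => Disjoint (𝓖.s '' V i) (𝓖.s '' V j))
    (h : ⋃ i, 𝓖.s '' U i = ⋃ i, 𝓖.s '' V i) :
    ∑ i, 𝓖.swapClass (U i) = ∑ i, 𝓖.swapClass (V i) := by
  have h1 : ∀ i, 𝓖.swapClass (U i) = ∑ j, 𝓖.swapClass (U i ∩ 𝓖.s ⁻¹' (𝓖.s '' V j)) := fun i => by
    rw [← swapClass_restrict_iUnion (hU i) (fun j => (hV j).1.isClopen_s) hVd, ← h,
      inter_eq_left.2]
    exact fun g hg => mem_iUnion.2 ⟨i, g, hg, rfl⟩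
  have h2 : ∀ j, 𝓖.swapClass (V j) = ∑ i, 𝓖.swapClass (V j ∩ 𝓖.s ⁻¹' (𝓖.s '' U i)) := fun i => by
    rw [← swapClass_restrict_iUnion (hV i) (fun j => (hU j).1.isClopen_s) hUd, h,
      inter_eq_left.2]
    exact fun g hg => mem_iUnion.2 ⟨i, g, hg, rfl⟩
  simp only [h1, h2]
  rw [Finset.sum_comm]
  refine Finset.sum_congr rfl fun j _ => Finset.sum_congr rfl fun i _ => ?_
  refine swapClass_eq_of_image_s_eq hmin hpi ((hU i).restrict (hV j).1.isClopen_s)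
    ((hV j).restrict (hU i).1.isClopen_s) ?_
  rw [image_s_restrict, image_s_restrict, inter_comm]

/-- Split the unit space into non-empty clopen halves `B` and `Bᶜ`; embed `A ∩ B` into `Bᶜ` and `A \
B` into `B`. -/
theorem exists_isSwapFamily [Nonempty X] [PerfectSpace X] (hmin : 𝓖.IsMinimal)
    (hpi : 𝓖.IsPurelyInfinite) {A : Set X} (hA : IsClopen A) :
    ∃ U : Fin 2 → Set G, 𝓖.IsSwapFamily A U := by
  obtain ⟨B, hB, h1, h2⟩ := (isOpen_univ (X := X)).exists_isClopen_split univ_nonempty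
  rw [univ_inter] at h1
  rw [← compl_eq_univ_sdiff] at h2
  obtain ⟨U, hU, hUs, hUr⟩ := exists_gset_into hmin hpi (hA.inter hB) hB.compl h2
  obtain ⟨V, hV, hVs, hVr⟩ := exists_gset_into hmin hpi (hA.inter hB.compl) hB h1
  refine ⟨![U, V], ?_, ?_, ?_, ?_⟩
  · simp [Fin.forall_fin_two, hU, hV]
  · simp only [Fin.forall_fin_two, Matrix.cons_val_zero, Matrix.cons_val_one, hUs, hVs,
      ← disjoint_iff_inter_eq_empty]
    exact ⟨disjoint_compl_left.mono hUr inter_subset_right,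
      disjoint_compl_right.mono hVr inter_subset_right⟩
  · have hd : Disjoint (𝓖.s '' U) (𝓖.s '' V) := by
      rw [hUs, hVs]
      exact disjoint_compl_right.mono inter_subset_right inter_subset_right
    intro i j hij
    fin_cases i <;> fin_cases j
    exacts [(hij rfl).elim, hd, hd.symm, (hij rfl).elim]
  · ext x
    simp only [mem_iUnion, Fin.exists_fin_two, Matrix.cons_val_zero, Matrix.cons_val_one, hUs, hVs]
    by_cases hx : x ∈ B <;> simp [hx]

variable [Nonempty X] [PerfectSpace X]

theorem sourceClass_eq_sum (hmin : 𝓖.IsMinimal) (hpi : 𝓖.IsPurelyInfinite)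
    {ι : Type*} [Fintype ι] {U : ι → Set G} (hU : ∀ i, 𝓖.IsSwapSet (U i))
    (hd : Pairwise fun i j => Disjoint (𝓖.s '' U i) (𝓖.s '' U j)) :
    𝓖.sourceClass (⋃ i, 𝓖.s '' U i) = ∑ i, 𝓖.swapClass (U i) := by
  have h := exists_isSwapFamily hmin hpi (isClopen_iUnion_of_finite fun i => (hU i).1.isClopen_s)
  rw [sourceClass, dif_pos h]
  exact sum_swapClass_eq hmin hpi h.choose_spec.isSwapSet hU h.choose_spec.pairwise_disjoint hd
    h.choose_spec.iUnion_eq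

theorem sourceClass_image_s (hmin : 𝓖.IsMinimal) (hpi : 𝓖.IsPurelyInfinite)
    {U : Set G} (hU : 𝓖.IsSwapSet U) : 𝓖.sourceClass (𝓖.s '' U) = 𝓖.swapClass U := by
  have := sourceClass_eq_sum hmin hpi (ι := Unit) (U := fun _ => U) (fun _ => hU)
    (fun i j hij => (hij rfl).elim)
  rwa [iUnion_const, Fintype.sum_unique] at this

theorem sourceClass_union (hmin : 𝓖.IsMinimal) (hpi : 𝓖.IsPurelyInfinite)
    {A B : Set X} (hA : IsClopen A) (hB : IsClopen B) (hd : Disjoint A B) :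
    𝓖.sourceClass (A ∪ B) = 𝓖.sourceClass A + 𝓖.sourceClass B := by
  obtain ⟨U, hU⟩ := exists_isSwapFamily hmin hpi hA
  obtain ⟨V, hV⟩ := exists_isSwapFamily hmin hpi hB
  have hAB : ∀ i j, Disjoint (𝓖.s '' U i) (𝓖.s '' V j) := fun i j =>
    hd.mono (hU.iUnion_eq ▸ subset_iUnion (fun i => 𝓖.s '' U i) i)
      (hV.iUnion_eq ▸ subset_iUnion (fun i => 𝓖.s '' V i) j)
  have h := sourceClass_eq_sum hmin hpi (ι := Fin 2 ⊕ Fin 2) (U := Sum.elim U V)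
    (by rintro (i | i); exacts [hU.isSwapSet i, hV.isSwapSet i])
    (by
      rintro (i | i) (j | j) hij
      · exact hU.pairwise_disjoint fun e => hij (congrArg _ e)
      · exact hAB i j
      · exact (hAB j i).symm
      · exact hV.pairwise_disjoint fun e => hij (congrArg _ e))
  rw [iUnion_sum, Fintype.sum_sum_type] at h
  simp only [Sum.elim_inl, Sum.elim_inr] at h
  rw [← sourceClass_eq_sum hmin hpi hU.isSwapSet hU.pairwise_disjoint,
    ← sourceClass_eq_sum hmin hpi hV.isSwapSet hV.pairwise_disjoint] at h
  rwa [hU.iUnion_eq, hV.iUnion_eq] at h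

end Swaps

end EtaleGroupoid

/-! ### The homomorphism `j` and exactness -/

/-- An involution which is free on a clopen set has a clopen fundamental domain there. -/
theorem Homeomorph.exists_isClopen_fundamentalDomain {X : Type*} [TopologicalSpace X]
    [CompactSpace X] [T2Space X] [TotallyDisconnectedSpace X] (τ : X ≃ₜ X) (hτ : ∀ x, τ (τ x) = x)
    (hF : IsClopen {x | τ x = x}) :
    ∃ A, IsClopen A ∧ Disjoint A (τ ⁻¹' A) ∧ A ∪ τ ⁻¹' A = {x | τ x = x}ᶜ := by
  -- The induction asks for a fundamental domain of the saturation `K ∪ τ⁻¹ K` of an arbitrary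
  -- compact open `K`, a form that passes to disjoint unions.
  have key : ∃ A, IsClopen A ∧ Disjoint A (τ ⁻¹' A) ∧
      A ∪ τ ⁻¹' A = {x | τ x = x}ᶜ ∪ τ ⁻¹' {x | τ x = x}ᶜ := by
    refine IsCompact.compactOpen_induction
      (P := fun K => ∃ A, IsClopen A ∧ Disjoint A (τ ⁻¹' A) ∧ A ∪ τ ⁻¹' A = K ∪ τ ⁻¹' K)
      ⟨∅, isClopen_empty, by simp, rfl⟩ ?_ hF.compl.isClosed.isCompact hF.compl.isOpen ?_
    · rintro K L hK hK' hL hL' - ⟨A, hA, hAd, hAK⟩ ⟨B, hB, hBd, hBL⟩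
      have hKc : IsClopen K := ⟨hK.isClosed, hK'⟩
      rw [disjoint_left] at hAd hBd
      simp only [Set.ext_iff, mem_union, mem_preimage] at hAK hBL
      -- `A` already represents all orbits meeting `K`; from `B` only the other orbits are kept.
      refine ⟨A ∪ (B \ (K ∪ τ ⁻¹' K)), hA.union (hB.diff (hKc.union (hKc.preimage τ.continuous))),
        ?_, ?_⟩
      · rw [disjoint_left]
        intro x
        have h1 := hAd (a := x)
        have h2 := hBd (a := x)
        have h3 := hAK x
        simp only [mem_union, Set.mem_sdiff, mem_preimage, hτ] at h1 h2 ⊢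
        tauto
      · ext x
        have h3 := hAK x
        have h4 := hBL x
        simp only [mem_union, Set.mem_sdiff, mem_preimage, hτ]
        tauto
    · intro x hx
      obtain ⟨u, v, hu, hv, hxu, hxv, huv⟩ := t2_separation (show τ x ≠ x from hx)
      obtain ⟨L, hL, hxL, hLs⟩ := compact_exists_isClopen_in_isOpen
        ((hu.preimage τ.continuous).inter hv) ⟨hxu, hxv⟩
      refine ⟨L, hL.isClosed.isCompact, hL.isOpen, hxL, fun A hA hc ho =>
        ⟨A, ⟨hc.isClosed, ho⟩, ?_, rfl⟩⟩
      rw [disjoint_left]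
      intro y hy hy'
      exact disjoint_left.1 huv (hLs (hA hy)).1 (hLs (hA hy')).2
  obtain ⟨A, hA, hd, h⟩ := key
  refine ⟨A, hA, hd, h.trans ?_⟩
  have : τ ⁻¹' {x | τ x = x}ᶜ = {x | τ x = x}ᶜ := by
    ext x
    simp only [mem_preimage, mem_compl_iff, mem_ofPred_eq, hτ, eq_comm]
  rw [this, union_self]

theorem isClopen_odd {X : Type*} [TopologicalSpace X] (f : C_c(X, ℤ)) :
    IsClopen {x | Odd (f x)} :=
  (isClopen_discrete {n : ℤ | Odd n}).preimage f.continuous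

/-- Every element of `M ⊗ ℤ₂` is of the form `m ⊗ 1`. -/
theorem exists_eq_tmul_one {M : Type*} [AddCommGroup M] (z : M ⊗[ℤ] ZMod 2) :
    ∃ m : M, z = m ⊗ₜ[ℤ] (1 : ZMod 2) := by
  induction z using TensorProduct.induction_on with
  | zero => exact ⟨0, (TensorProduct.zero_tmul _ _).symm⟩
  | tmul m k =>
    obtain ⟨k, rfl⟩ := ZMod.intCast_surjective k
    refine ⟨k • m, ?_⟩
    rw [TensorProduct.smul_tmul, zsmul_one]
  | add y z hy hz =>
    obtain ⟨m, rfl⟩ := hy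
    obtain ⟨n, rfl⟩ := hz
    exact ⟨m + n, (TensorProduct.add_tmul _ _ _).symm⟩

/-- A homomorphism into a group of exponent two factors through the tensor product with `ℤ₂`. -/
theorem exists_addMonoidHom_tmul_one {M A : Type*} [AddCommGroup M] [AddCommGroup A] (φ : M →+ A)
    (hφ : ∀ m, φ m + φ m = 0) :
    ∃ j : (M ⊗[ℤ] ZMod 2) →+ A, ∀ m, j (m ⊗ₜ[ℤ] (1 : ZMod 2)) = φ m := by
  have hc : ∀ m, zmultiplesHom A (φ m) (2 : ℕ) = 0 := fun m => by
    simpa [two_zsmul] using hφ m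
  let ψ : M →+ ZMod 2 →+ A := AddMonoidHom.mk' (fun m => ZMod.lift 2 ⟨_, hc m⟩) fun m n => by
    refine AddMonoidHom.ext fun k => ?_
    obtain ⟨k, rfl⟩ := ZMod.intCast_surjective k
    rw [AddMonoidHom.add_apply, ZMod.lift_coe, ZMod.lift_coe, ZMod.lift_coe]
    simp [smul_add]
  refine ⟨TensorProduct.liftAddHom ψ fun r m k => ?_, fun m => ?_⟩
  · rw [map_zsmul, map_zsmul, AddMonoidHom.zsmul_apply]
  · rw [TensorProduct.liftAddHom_tmul]
    change ZMod.lift 2 ⟨_, hc m⟩ 1 = φ m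
    rw [← Int.cast_one, ZMod.lift_coe]
    simp

namespace EtaleGroupoid

section Exactness

variable {X G : Type*} [TopologicalSpace X] [TopologicalSpace G]
  [SecondCountableTopology G] [LocallyCompactSpace G] [T2Space G] {𝓖 : EtaleGroupoid X G}
  [CompactSpace X] [T2Space X] [TotallyDisconnectedSpace X]

/-- Every transposition is of the form `τ_U`. -/
theorem IsTransposition.exists_eq_swap {τ : 𝓖.fullGroup} (hτ : 𝓖.IsTransposition τ) :
    ∃ (U : Set G) (hU : 𝓖.IsSwapSet U), τ = 𝓖.swap U hU.1 hU.2 := by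
  have hinv : ∀ x, τ.1 (τ.1 x) = x := fun x => by
    rw [← fullGroup_mul_apply, ← pow_two, hτ.1]
    rfl
  -- The required `U` is the part of the `𝓖`-set of `τ` with source in a fundamental domain `A`; its
  -- range is `τ⁻¹ A`.
  obtain ⟨A, hA, hd, hAF⟩ := τ.1.exists_isClopen_fundamentalDomain hinv hτ.2
  obtain ⟨W, hW, hWτ⟩ := τ.2
  have hs : 𝓖.s '' (W ∩ 𝓖.s ⁻¹' A) = A := by rw [image_s_restrict, hWτ.image_s, univ_inter]
  have hr : 𝓖.r '' (W ∩ 𝓖.s ⁻¹' A) = τ.1 ⁻¹' A := by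
    ext x
    constructor
    · rintro ⟨g, ⟨hg, hgA⟩, rfl⟩
      rw [mem_preimage, ← hWτ.apply_s g hg, hinv]
      exact hgA
    · intro hx
      obtain ⟨g, hg, e⟩ := hWτ.image_s.ge (mem_univ (τ.1 x))
      exact ⟨g, ⟨hg, by rwa [mem_preimage, e]⟩, by rw [← hWτ.apply_s g hg, e, hinv]⟩
  have hU : 𝓖.IsSwapSet (W ∩ 𝓖.s ⁻¹' A) := ⟨hW.restrict hA, by
    rw [hs, hr, ← disjoint_iff_inter_eq_empty]
    exact hd.symm⟩
  refine ⟨_, hU, eq_swap hU (fun g hg => hWτ.apply_s g hg.1) (fun g hg => ?_) fun x hx => ?_⟩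
  · rw [← hWτ.apply_s g hg.1, hinv]
  · rw [hs, hr, hAF, notMem_compl_iff] at hx
    exact hx

/-- By TR the kernel of the index map is generated by transpositions, which are exactly the swaps;
their classes lie in the image of `j`, and the values of `j` are classes of products of swaps. -/
theorem IsSwapHom.exact {j : (𝓖.H₀ ⊗[ℤ] ZMod 2) →+ Additive (Abelianization 𝓖.fullGroup)}
    (hj : 𝓖.IsSwapHom j) (hep : 𝓖.IsEssentiallyPrincipal) (hTR : 𝓖.PropertyTR hep) :
    Function.Exact j (𝓖.abelianizedIndexMap hep) := by
  intro y
  constructor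
  · intro hy
    obtain ⟨α, hα⟩ := QuotientGroup.mk'_surjective (commutator 𝓖.fullGroup) y.toMul
    obtain rfl : Additive.ofMul (Abelianization.of α) = y := congrArg Additive.ofMul hα
    have hmem : α ∈ Subgroup.closure {τ | 𝓖.IsTransposition τ} := by
      rw [← hTR, MonoidHom.mem_ker]
      exact congrArg Multiplicative.ofAdd hy
    change _ ∈ j.range
    clear hy hα
    induction hmem using Subgroup.closure_induction with
    | mem τ hτ =>
      obtain ⟨U, hU, rfl⟩ := IsTransposition.exists_eq_swap hτ
      -- The one-member family `U` computes `j` on the class of `1_{s(U)}`, giving the class of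
      -- `τ_U`.
      have hfam : 𝓖.IsSwapFamily {x | Odd (charFun (𝓖.s '' U)
          (hU.1.isCompact.image continuous_s) hU.1.isClopen_s.isOpen x)} (fun _ : Fin 1 => U) := by
        refine ⟨fun _ => hU.1, fun _ => hU.2, fun i j hij => (hij (Subsingleton.elim _ _)).elim, ?_⟩
        rw [iUnion_const]
        ext x
        by_cases hx : x ∈ 𝓖.s '' U <;> simp only [charFun_apply, mem_ofPred_eq, hx,
          indicator_of_mem, indicator_of_notMem, not_false_eq_true] <;> simp
      refine ⟨_, ((hj _).2 1 _ hfam).trans ?_⟩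
      simp
    | one => exact j.range.zero_mem
    | mul α β _ _ h1 h2 =>
      rw [map_mul, ofMul_mul]
      exact j.range.add_mem h1 h2
    | inv α _ h =>
      rw [map_inv, ofMul_inv]
      exact j.range.neg_mem h
  · rintro ⟨z, rfl⟩
    obtain ⟨m, rfl⟩ := exists_eq_tmul_one z
    obtain ⟨f, rfl⟩ := QuotientAddGroup.mk_surjective m
    obtain ⟨⟨n, U, hU⟩, h⟩ := hj f
    rw [h n U hU]
    refine congrArg Multiplicative.toAdd (?_ : 𝓖.indexMap hep _ = 1)
    rw [← MonoidHom.mem_ker, hTR]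
    refine Subgroup.list_prod_mem _ fun α hα => ?_
    obtain ⟨i, rfl⟩ := List.mem_ofFn.1 hα
    exact Subgroup.subset_closure (isTransposition_swap (hU.isSwapSet i))

variable [Nonempty X] [PerfectSpace X]

/-- The homomorphism on `C(𝓖⁽⁰⁾, ℤ)` which induces `j`. -/
noncomputable def oddHom (hmin : 𝓖.IsMinimal) (hpi : 𝓖.IsPurelyInfinite) :
    C_c(X, ℤ) →+ Additive (Abelianization 𝓖.fullGroup) :=
  AddMonoidHom.mk' (fun f => 𝓖.sourceClass {x | Odd (f x)}) fun f g => by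
    have hf := isClopen_odd f
    have hg := isClopen_odd g
    -- The odd set of a sum is the symmetric difference of the odd sets. The intersection, counted
    -- twice, contributes nothing since source classes are killed by 2.
    have h : {x | Odd ((f + g) x)} =
        ({x | Odd (f x)} \ {x | Odd (g x)}) ∪ ({x | Odd (g x)} \ {x | Odd (f x)}) := by
      ext x
      simp only [mem_union, Set.mem_sdiff, mem_ofPred_eq, CompactlySupportedContinuousMap.coe_add,
        Pi.add_apply, Int.odd_add, ← Int.not_odd_iff_even]
      tauto
    rw [h, sourceClass_union hmin hpi (hf.diff hg) (hg.diff hf)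
      (disjoint_sdiff_left.mono_right sdiff_subset)]
    have h1 := sourceClass_union hmin hpi (hf.inter hg) (hf.diff hg) disjoint_sdiff_inter.symm
    have h2 := sourceClass_union hmin hpi (hg.inter hf) (hg.diff hf) disjoint_sdiff_inter.symm
    rw [inter_union_sdiff] at h1 h2
    rw [h1, h2, inter_comm, add_add_add_comm, sourceClass_add_self, zero_add]

theorem oddHom_charFun (hmin : 𝓖.IsMinimal) (hpi : 𝓖.IsPurelyInfinite) {A : Set X}
    (hA : IsCompact A) (hA' : IsOpen A) :
    oddHom hmin hpi (charFun A hA hA') = 𝓖.sourceClass A := by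
  refine congrArg 𝓖.sourceClass ?_
  ext x
  by_cases hx : x ∈ A <;> simp [charFun_apply, hx]

/-- Embed `s(U)` by `W` into the complement of `s(U) ∪ r(U)`. Then `W` and `W U⁻¹` are swap sets
with sources `s(U)` and `r(U)` and the same range, and passing to inverses turns the common range
into a common source. -/
theorem sourceClass_image_r (hmin : 𝓖.IsMinimal) (hpi : 𝓖.IsPurelyInfinite) {U : Set G}
    (hU : 𝓖.IsCompactOpenGSet U) (hne : (𝓖.s '' U ∪ 𝓖.r '' U)ᶜ.Nonempty) :
    𝓖.sourceClass (𝓖.s '' U) = 𝓖.sourceClass (𝓖.r '' U) := by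
  obtain ⟨W, hW, hWs, hWr⟩ := exists_gset_into hmin hpi hU.isClopen_s
    (hU.isClopen_s.union hU.isClopen_r).compl hne
  simp only [compl_union, subset_inter_iff] at hWr
  have hW' : 𝓖.IsSwapSet W := ⟨hW, by
    rw [← disjoint_iff_inter_eq_empty, hWs]
    exact disjoint_compl_left.mono_left hWr.1⟩
  have hWU : 𝓖.s '' W = 𝓖.r '' (𝓖.inv '' U) := by rw [image_r_inv, hWs]
  have hVs : 𝓖.s '' 𝓖.setMul W (𝓖.inv '' U) = 𝓖.r '' U := by
    rw [image_s_setMul hWU.ge, image_s_inv]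
  have hVr : 𝓖.r '' 𝓖.setMul W (𝓖.inv '' U) = 𝓖.r '' W := image_r_setMul hWU.le
  have hV : 𝓖.IsSwapSet (𝓖.setMul W (𝓖.inv '' U)) := ⟨hW.mul hU.inv, by
    rw [← disjoint_iff_inter_eq_empty, hVs, hVr]
    exact disjoint_compl_left.mono_left hWr.2⟩
  rw [← hWs, ← hVs, sourceClass_image_s hmin hpi hW', sourceClass_image_s hmin hpi hV,
    ← swapClass_inv hW', ← swapClass_inv hV, ← sourceClass_image_s hmin hpi hW'.inv,
    ← sourceClass_image_s hmin hpi hV.inv, image_s_inv, image_s_inv, hVr]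

/-- Chains are generated by characteristic functions of small `𝓖`-sets, and those leave enough room
for `sourceClass_image_r`. -/
theorem oddHom_boundary₁ (hmin : 𝓖.IsMinimal) (hpi : 𝓖.IsPurelyInfinite) (f : C_c(G, ℤ)) :
    oddHom hmin hpi (𝓖.boundary₁ f) = 0 := by
  refine mem_of_charFun_mem (S := ((oddHom hmin hpi).comp 𝓖.boundary₁).ker) (fun g => ?_) f
  -- The unit space is infinite, so some `x` differs from `s g` and `r g`; a `𝓖`-set around `g`
  -- whose source and range avoid `x` has the free point needed.
  obtain ⟨x, hx⟩ := (infinite_of_mem_nhds (𝓖.s g) univ_mem).exists_notMem_finite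
    (toFinite {𝓖.s g, 𝓖.r g})
  obtain ⟨U, hU, hg, hUx⟩ := exists_isCompactOpenGSet (𝓖 := 𝓖) (O := 𝓖.s ⁻¹' {x}ᶜ ∩ 𝓖.r ⁻¹' {x}ᶜ)
    ((isOpen_compl_singleton.preimage continuous_s).inter
      (isOpen_compl_singleton.preimage continuous_r))
    ⟨fun e => hx.2 (Or.inl (e : 𝓖.s g = x).symm), fun e => hx.2 (Or.inr (e : 𝓖.r g = x).symm)⟩
  refine ⟨U, hU.isCompact, hU.isOpen, hg, fun A hA hc ho => ?_⟩
  have hA' := hU.subset hA hc ho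
  rw [AddMonoidHom.mem_ker, AddMonoidHom.comp_apply, boundary₁_charFun hA', map_sub,
    oddHom_charFun, oddHom_charFun, sourceClass_image_r hmin hpi hA' ⟨x, ?_⟩, sub_self]
  rintro (⟨h, hh, e⟩ | ⟨h, hh, e⟩)
  exacts [(hUx (hA hh)).1 e, (hUx (hA hh)).2 e]

/-- `oddHom` kills boundaries and takes values of order dividing two, so it descends to `H₀ ⊗ ℤ₂`.
Its value can be computed from any swap family because the class depends on the sources alone. -/
theorem exists_isSwapHom (hmin : 𝓖.IsMinimal) (hpi : 𝓖.IsPurelyInfinite) :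
    ∃ j : (𝓖.H₀ ⊗[ℤ] ZMod 2) →+ Additive (Abelianization 𝓖.fullGroup), 𝓖.IsSwapHom j := by
  let φ : 𝓖.H₀ →+ Additive (Abelianization 𝓖.fullGroup) :=
    QuotientAddGroup.lift _ (oddHom hmin hpi) (by
      rintro _ ⟨f, rfl⟩
      exact oddHom_boundary₁ hmin hpi f)
  obtain ⟨j, hj⟩ := exists_addMonoidHom_tmul_one φ (fun m => by
    obtain ⟨f, rfl⟩ := QuotientAddGroup.mk_surjective m
    exact sourceClass_add_self _)
  refine ⟨j, fun f => ⟨⟨2, exists_isSwapFamily hmin hpi (isClopen_odd f)⟩, fun n U hU => ?_⟩⟩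
  rw [hj]
  change 𝓖.sourceClass {x | Odd (f x)} = _
  rw [map_list_prod, List.map_ofFn, List.prod_ofFn, ofMul_prod]
  have h := sourceClass_eq_sum hmin hpi hU.isSwapSet hU.pairwise_disjoint
  rw [hU.iUnion_eq] at h
  rw [h]
  exact Finset.sum_congr rfl fun i _ => swapClass_eq (hU.isSwapSet i)

end Exactness

end EtaleGroupoid

/-- The AH conjecture for minimal purely infinite groupoids with property TR. -/
theorem mainTheorem8 {X G : Type*} [TopologicalSpace X] [TopologicalSpace G]
    [SecondCountableTopology G] [LocallyCompactSpace G] [T2Space G]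
    [Nonempty X] [CompactSpace X] [TopologicalSpace.MetrizableSpace X]
    [TotallyDisconnectedSpace X] [PerfectSpace X]
    (𝓖 : EtaleGroupoid X G) (hep : 𝓖.IsEssentiallyPrincipal) (hmin : 𝓖.IsMinimal)
    (hpi : 𝓖.IsPurelyInfinite) (hTR : 𝓖.PropertyTR hep) :
    (∃ j : (𝓖.H₀ ⊗[ℤ] ZMod 2) →+ Additive (Abelianization 𝓖.fullGroup),
      𝓖.IsSwapHom j ∧ Function.Exact j (𝓖.abelianizedIndexMap hep)) ∧
    Function.Surjective (𝓖.abelianizedIndexMap hep) ∧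
    ((∀ a : 𝓖.H₀, ∃ b : 𝓖.H₀, a = 2 • b) →
      Function.Bijective (𝓖.abelianizedIndexMap hep)) := by
  obtain ⟨j, hj⟩ := 𝓖.exists_isSwapHom hmin hpi
  have hexact := hj.exact hep hTR
  have hsurj : Function.Surjective (𝓖.abelianizedIndexMap hep) := fun y => by
    obtain ⟨α, hα⟩ := EtaleGroupoid.indexMap_surjective hep hpi (Multiplicative.ofAdd y)
    exact ⟨Additive.ofMul (Abelianization.of α), congrArg Multiplicative.toAdd hα⟩
  refine ⟨⟨j, hj, hexact⟩, hsurj, fun hdiv => ⟨?_, hsurj⟩⟩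
  rw [injective_iff_map_eq_zero]
  intro y hy
  obtain ⟨z, rfl⟩ := (hexact y).1 hy
  obtain ⟨a, rfl⟩ := exists_eq_tmul_one z
  obtain ⟨b, rfl⟩ := hdiv a
  -- Here `2b ⊗ 1 = b ⊗ 2 = 0`, so `j` vanishes and exactness makes `I` injective.
  rw [TensorProduct.smul_tmul, two_nsmul, show (1 : ZMod 2) + 1 = 0 from rfl,
    TensorProduct.tmul_zero, map_zero]
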